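/- All graphs are finite and simple. To double subdivide an edge $uv$ of a graph means to delete the edge $uv$, add two new vertices, and join both of them to $u$ and to $v$. A generalised triangle is $K_3$ or any graph obtained from $K_3$ by a finite sequence of double subdivisions of edges. A $2$-cut of a graph $G$ is a set $\{x,y\}$ of two vertices whose removal increases the number of connected components. For a $2$-cut $\{x,y\}$ of $G$, an $\{x,y\}$-bridge is a subgraph $G[V(C)\cup\{x,y\}]$, where $C$ is a connected component of $G-\{x,y\}$. Let $\mathcal{K}_1$ be the class of generalised triangles $G$ such that for every $2$-cut $\{x,y\}$ of $G$ and every $\{x,y\}$-bridge $B$, at least one of $x$ and $y$ has degree $1$ in $B$. Let $H_0$ be the graph formed from $K_3$ by double subdividing each of its three edges. If $G$ is a generalised triangle, then $G \in \mathcal{K}_1$ if and only if $H_0$ is not a minor of $G$. -/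

import Mathlib

namespace SimpleGraph

universe u v

/-- `G.doubleSubdivision a b`, for an edge `ab` of `G`: delete the edge `ab`, add two new
vertices, and join both of them to `a` and to `b`. -/
def doubleSubdivision {V : Type u} (G : SimpleGraph V) (a b : V) : SimpleGraph (V ⊕ Fin 2) where
  Adj
    | .inl p, .inl q => (G.deleteEdges {s(a, b)}).Adj p q
    | .inl p, .inr _ => p = a ∨ p = b
    | .inr _, .inl q => q = a ∨ q = b
    | .inr _, .inr _ => False
  symm := ⟨by
    rintro (p | p) (q | q) h
    · exact h.symm
    · exact h
    · exact h
    · exact h⟩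
  loopless := ⟨by
    rintro (p | p) h
    · exact h.ne rfl
    · exact h⟩

/-- A graph is a generalised triangle if it is (isomorphic to) `K₃` or is obtained from `K₃`
by a sequence of double subdivisions of edges. -/
inductive IsGeneralisedTriangle : {V : Type u} → SimpleGraph V → Prop
  | triangle {V : Type u} {G : SimpleGraph V}
      (e : G ≃g (⊤ : SimpleGraph (Fin 3))) : IsGeneralisedTriangle G
  | doubleSubdivision {V W : Type u} {G : SimpleGraph V} {H : SimpleGraph W} {a b : V}
      (hG : IsGeneralisedTriangle G) (hab : G.Adj a b)
      (e : H ≃g G.doubleSubdivision a b) : IsGeneralisedTriangle H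

/-- A set of vertices whose removal increases the number of components
(for graphs with finitely many vertices). -/
def IsCutSet {V : Type u} (G : SimpleGraph V) (S : Set V) : Prop :=
  Nat.card G.ConnectedComponent < Nat.card (G.induce Sᶜ).ConnectedComponent

/-- `{x, y}` is a 2-cut of `G`: a cut-set with exactly two elements. -/
def IsTwoCut {V : Type u} (G : SimpleGraph V) (x y : V) : Prop :=
  x ≠ y ∧ G.IsCutSet {x, y}

/-- The `{x, y}`-bridge of `G` belonging to a component `C` of `G - {x, y}`:
the subgraph of `G` induced by `V(C) ∪ {x, y}`. -/
def twoCutBridge {V : Type u} (G : SimpleGraph V) (x y : V)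
    (C : (G.induce ({x, y} : Set V)ᶜ).ConnectedComponent) : G.Subgraph :=
  (⊤ : G.Subgraph).induce (Subtype.val '' C.supp ∪ {x, y})

/-- Property `P₁` of a 2-cut `{x, y}`: in every `{x, y}`-bridge,
at least one of `x` and `y` has degree 1. -/
def PropertyP1 {V : Type u} (G : SimpleGraph V) (x y : V) : Prop :=
  ∀ C : (G.induce ({x, y} : Set V)ᶜ).ConnectedComponent,
    ((G.twoCutBridge x y C).neighborSet x).ncard = 1 ∨
      ((G.twoCutBridge x y C).neighborSet y).ncard = 1

/-- The class `K₁`: the generalised triangles all of whose 2-cuts have property `P₁`. -/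
def MemK1 {V : Type u} (G : SimpleGraph V) : Prop :=
  G.IsGeneralisedTriangle ∧ ∀ x y : V, G.IsTwoCut x y → G.PropertyP1 x y

/-- `H` is a minor of `G`: there are pairwise disjoint (nonempty) connected branch sets in `G`,
one for each vertex of `H`, with an edge of `G` between the branch sets of any two adjacent
vertices of `H`. -/
def IsMinor {W : Type v} {V : Type u} (H : SimpleGraph W) (G : SimpleGraph V) : Prop :=
  ∃ B : W → Set V,
    (∀ w, (G.induce (B w)).Connected) ∧
    (∀ w w', w ≠ w' → Disjoint (B w) (B w')) ∧
    ∀ w w', H.Adj w w' → ∃ p ∈ B w, ∃ q ∈ B w', G.Adj p q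

/-- `H₀`: the graph formed from `K₃`, with vertices `0, 1, 2`, by applying the double
subdivision operation to each of its edges `01`, `12` and `02`. -/
def H0 : SimpleGraph (((Fin 3 ⊕ Fin 2) ⊕ Fin 2) ⊕ Fin 2) :=
  (((⊤ : SimpleGraph (Fin 3)).doubleSubdivision 0 1).doubleSubdivision
    (.inl 1) (.inl 2)).doubleSubdivision (.inl (.inl 0)) (.inl (.inl 2))

end SimpleGraph

/-!
Call a component `C` of `G - {x, y}` thick if `x` and `y` both have at least two neighbours in `C`,
so that thick components of 2-cuts are exactly what `P₁` forbids. That a thick 2-cut exists if and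
only if `H₀` is a minor is preserved when an edge `ab` of a generalised triangle other than `K₃` is
double subdivided. If `a` and `b` both have degree at least three, the new graph satisfies both
sides: the rest of `G` becomes a thick component at `{a, b}`, and every such edge `ab` is the
unsubdivided edge of a minor formed from `K₃` by double subdividing two edges. Otherwise one end,
say `a`, has only the neighbours `b` and `c`, and double subdividing `ab` changes neither side:
besides `{a}` there are two further components of `G - {b, c}`. They prevent new thick 2-cuts, and
branch sets of `H₀` that use the new vertices can be rerouted through `a` and these components.
-/

namespace GeneralisedTriangle

open SimpleGraph

variable {V V' W W' : Type*}

section Connectivity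

variable {G : SimpleGraph V} {S : Set V}

theorem connected_induce_iff_forall_closed :
    (G.induce S).Connected ↔ S.Nonempty ∧ ∀ T : Set V, (S ∩ T).Nonempty →
      (∀ u ∈ S ∩ T, ∀ v ∈ S, G.Adj u v → v ∈ T) → S ⊆ T := by
  constructor
  · refine fun h => ⟨Set.nonempty_coe_sort.1 h.nonempty, fun T ⟨t, htS, htT⟩ hT s hs => ?_⟩
    by_contra hsT
    obtain ⟨p⟩ := h.preconnected ⟨t, htS⟩ ⟨s, hs⟩
    obtain ⟨d, -, hfst, hsnd⟩ := p.exists_boundary_dart (Subtype.val ⁻¹' T) htT hsT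
    exact hsnd (hT _ ⟨d.fst.2, hfst⟩ _ d.snd.2 d.adj)
  · rintro ⟨hne, h⟩
    have := hne.coe_sort
    refine ⟨fun u v => ?_⟩
    have hreach := h {w | ∃ hw : w ∈ S, (G.induce S).Reachable u ⟨w, hw⟩} ⟨u, u.2, u.2, .rfl⟩
      fun w ⟨_, _, hr⟩ z hz hwz => ⟨hz, hr.trans (Adj.reachable hwz)⟩
    exact (hreach v.2).2

theorem nonempty_of_connected_induce (h : (G.induce S).Connected) : S.Nonempty :=
  (connected_induce_iff_forall_closed.1 h).1

theorem subset_of_connected_induce (h : (G.induce S).Connected) {T : Set V}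
    (hne : (S ∩ T).Nonempty) (hT : ∀ u ∈ S ∩ T, ∀ v ∈ S, G.Adj u v → v ∈ T) : S ⊆ T :=
  (connected_induce_iff_forall_closed.1 h).2 T hne hT

theorem connected_induce_singleton (G : SimpleGraph V) (v : V) : (G.induce {v}).Connected :=
  .of_subsingleton

theorem connected_induce_preimage_iff {G' : SimpleGraph V'} (e : G ≃g G') {S : Set V'} :
    (G.induce (e ⁻¹' S)).Connected ↔ (G'.induce S).Connected :=
  (e.induce (e.toEquiv.bijOn fun _ => Iff.rfl)).connected_iff

theorem exists_adj_mem_of_connected_induce (h : (G.induce S).Connected) {u v : V} (hu : u ∈ S)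
    (hv : v ∈ S) (hvu : v ≠ u) : ∃ w ∈ S, G.Adj u w := by
  have : Nontrivial S := ⟨⟨u, hu⟩, ⟨v, hv⟩, fun huv => hvu (congrArg Subtype.val huv).symm⟩
  obtain ⟨w, hw⟩ := h.preconnected.exists_adj_of_nontrivial ⟨u, hu⟩
  exact ⟨w, w.2, hw⟩

theorem connected_induce_sdiff {R : Set V} {z : V} (h : (G.induce S).Connected) (hzS : z ∈ S)
    (hzR : z ∉ R) (hR : ∀ u ∈ S \ R, ∀ r ∈ S ∩ R, G.Adj u r → u = z) :
    (G.induce (S \ R)).Connected := by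
  have mem_of_closed : ∀ T, ((S \ R) ∩ T).Nonempty →
      (∀ u ∈ (S \ R) ∩ T, ∀ v ∈ S \ R, G.Adj u v → v ∈ T) → z ∈ T := by
    intro T hne hT
    by_contra hzT
    refine hzT (subset_of_connected_induce h (T := (S \ R) ∩ T) ?_ ?_ hzS).2
    · exact hne.mono fun t ht => ⟨ht.1.1, ht⟩
    · rintro u ⟨-, hu⟩ v hv huv
      have hvR : v ∉ R := fun hvR => hzT (hR u hu.1 v ⟨hv, hvR⟩ huv ▸ hu.2)
      exact ⟨⟨hv, hvR⟩, hT u hu v ⟨hv, hvR⟩ huv⟩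
  refine connected_induce_iff_forall_closed.2 ⟨⟨z, hzS, hzR⟩, fun T hne hT s hs => ?_⟩
  by_contra hsT
  have hzT : z ∈ Tᶜ := mem_of_closed Tᶜ ⟨s, hs, hsT⟩
    fun u hu v hv huv hvT => hu.2 (hT v ⟨hv, hvT⟩ u hu.1 huv.symm)
  exact hzT (mem_of_closed T hne hT)

end Connectivity

section CutComponent

variable {G : SimpleGraph V} {x y : V} {C : Set V}

/-- `C` is the vertex set of a connected component of `G - {x, y}`. It is encoded as a connected
subset of `V`, maximal among those avoiding `x` and `y`, rather than as a component of the induced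
graph on the subtype `{x, y}ᶜ`, so that components for different cuts can be compared. -/
structure IsCutComponent (G : SimpleGraph V) (x y : V) (C : Set V) : Prop where
  connected : (G.induce C).Connected
  left_notMem : x ∉ C
  right_notMem : y ∉ C
  mem_of_adj : ∀ {u v}, u ∈ C → G.Adj u v → v ≠ x → v ≠ y → v ∈ C

theorem IsCutComponent.symm (h : IsCutComponent G x y C) : IsCutComponent G y x C :=
  ⟨h.connected, h.right_notMem, h.left_notMem, fun hu huv hy hx => h.mem_of_adj hu huv hx hy⟩

theorem IsCutComponent.subset_of_connected (h : IsCutComponent G x y C) {S : Set V}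
    (hS : (G.induce S).Connected) (hx : x ∉ S) (hy : y ∉ S) (hne : (S ∩ C).Nonempty) : S ⊆ C :=
  subset_of_connected_induce hS hne fun _ hu _ hv huv =>
    h.mem_of_adj hu.2 huv (ne_of_mem_of_not_mem hv hx) (ne_of_mem_of_not_mem hv hy)

theorem IsCutComponent.subset_of_adj (h : IsCutComponent G x y C) {S : Set V}
    (hS : (G.induce S).Connected) (hx : x ∉ S) (hy : y ∉ S) {u v : V} (hu : u ∈ C) (hv : v ∈ S)
    (huv : G.Adj u v) : S ⊆ C :=
  h.subset_of_connected hS hx hy ⟨v, hv, h.mem_of_adj hu huv (ne_of_mem_of_not_mem hv hx)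
    (ne_of_mem_of_not_mem hv hy)⟩

theorem IsCutComponent.connected_sdiff (h : IsCutComponent G x y C) {S : Set V}
    (hS : (G.induce S).Connected) (hx : x ∈ S) (hy : y ∉ S) : (G.induce (S \ C)).Connected := by
  refine connected_induce_sdiff hS hx h.left_notMem fun u hu r hr hur => ?_
  by_contra hux
  exact hu.2 (h.mem_of_adj hr.2 hur.symm hux (ne_of_mem_of_not_mem hu.1 hy))

theorem isCutComponent_singleton {s : V} (hs : G.neighborSet s = {x, y}) :
    IsCutComponent G x y {s} := by
  have hx : G.Adj s x := hs.ge (by simp)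
  have hy : G.Adj s y := hs.ge (by simp)
  refine ⟨connected_induce_singleton G s, hx.ne', hy.ne', ?_⟩
  rintro _ v rfl hsv hvx hvy
  exact ((hs.le hsv).elim hvx hvy).elim

theorem IsCutComponent.map_iso {G' : SimpleGraph V'} (h : IsCutComponent G x y C) (e : G ≃g G') :
    IsCutComponent G' (e x) (e y) (e.symm ⁻¹' C) where
  connected := (connected_induce_preimage_iff e.symm).2 h.connected
  left_notMem := by simpa using h.left_notMem
  right_notMem := by simpa using h.right_notMem
  mem_of_adj hu huv hvx hvy := h.mem_of_adj hu (e.symm.map_adj_iff.2 huv)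
    (fun h => hvx (by simp [← h])) (fun h => hvy (by simp [← h]))

theorem isCutComponent_image_supp (K : (G.induce ({x, y} : Set V)ᶜ).ConnectedComponent) :
    IsCutComponent G x y (Subtype.val '' K.supp) where
  connected :=
    have e : K.toSimpleGraph ≃g G.induce (Subtype.val '' K.supp) :=
      ⟨Equiv.Set.image _ K.supp Subtype.val_injective, Iff.rfl⟩
    e.connected_iff.1 K.connected_toSimpleGraph
  left_notMem := by simp
  right_notMem := by simp
  mem_of_adj := by
    rintro _ v ⟨u, hu, rfl⟩ huv hvx hvy
    have hv : v ∈ ({x, y} : Set V)ᶜ := by simp [hvx, hvy]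
    exact ⟨⟨v, hv⟩, K.mem_supp_of_adj_mem_supp hu huv, rfl⟩

theorem IsCutComponent.exists_image_supp_eq (h : IsCutComponent G x y C) :
    ∃ K : (G.induce ({x, y} : Set V)ᶜ).ConnectedComponent, Subtype.val '' K.supp = C := by
  obtain ⟨u, hu⟩ := nonempty_of_connected_induce h.connected
  have hcompl : ∀ {v}, v ∈ C → v ∈ ({x, y} : Set V)ᶜ := fun hv => by
    simp [ne_of_mem_of_not_mem hv h.left_notMem, ne_of_mem_of_not_mem hv h.right_notMem]
  let K := (G.induce ({x, y} : Set V)ᶜ).connectedComponentMk ⟨u, hcompl hu⟩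
  have hK : IsCutComponent G x y (Subtype.val '' K.supp) := isCutComponent_image_supp K
  have huK : u ∈ Subtype.val '' K.supp := ⟨⟨u, hcompl hu⟩, rfl, rfl⟩
  refine ⟨K, Set.Subset.antisymm ?_ ?_⟩
  · exact h.subset_of_connected hK.connected hK.left_notMem hK.right_notMem ⟨u, huK, hu⟩
  · exact hK.subset_of_connected h.connected h.left_notMem h.right_notMem ⟨u, hu, huK⟩

end CutComponent

section EdgeRobust

variable {G : SimpleGraph V} {u v x y : V} {C : Set V}

/-- `G` is connected and remains so when any vertex, or the two ends of any edge, are deleted.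
Generalised triangles have this property, so the two vertices of a 2-cut are not adjacent. -/
structure IsEdgeRobust (G : SimpleGraph V) : Prop where
  connected : G.Connected
  connected_compl_singleton : ∀ v, (G.induce {v}ᶜ).Connected
  connected_compl_pair : ∀ {u v}, G.Adj u v → (G.induce {u, v}ᶜ).Connected

theorem IsEdgeRobust.map_iso {G' : SimpleGraph V'} (h : IsEdgeRobust G) (e : G ≃g G') :
    IsEdgeRobust G' where
  connected := e.connected_iff.1 h.connected
  connected_compl_singleton v := by
    have hv : e.symm ⁻¹' {e.symm v}ᶜ = {v}ᶜ := by ext; simp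
    exact hv ▸ (connected_induce_preimage_iff e.symm).2 (h.connected_compl_singleton (e.symm v))
  connected_compl_pair {u v} huv := by
    have huv' : e.symm ⁻¹' {e.symm u, e.symm v}ᶜ = {u, v}ᶜ := by ext; simp
    exact huv' ▸ (connected_induce_preimage_iff e.symm).2
      (h.connected_compl_pair (e.symm.map_adj_iff.2 huv))

theorem IsEdgeRobust.exists_adj_ne (h : IsEdgeRobust G) (huv : G.Adj u v) :
    ∃ w ≠ v, G.Adj u w := by
  obtain ⟨w, hw⟩ := nonempty_of_connected_induce (h.connected_compl_pair huv)
  obtain ⟨hwu, hwv⟩ : w ≠ u ∧ w ≠ v := by simpa using hw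
  exact exists_adj_mem_of_connected_induce (h.connected_compl_singleton v) huv.ne hwv hwu

theorem IsEdgeRobust.nontrivial_or_neighborSet_eq_pair (h : IsEdgeRobust G) (huv : G.Adj u v) :
    (G.neighborSet u \ {v}).Nontrivial ∨ ∃ w ≠ v, G.neighborSet u = {v, w} := by
  obtain ⟨w, hwv, huw⟩ := h.exists_adj_ne huv
  obtain hw | hw := Set.Nonempty.exists_eq_singleton_or_nontrivial (s := G.neighborSet u \ {v})
    ⟨w, huw, hwv⟩
  · obtain ⟨w, hw⟩ := hw
    have hmem : w ∈ G.neighborSet u \ {v} := hw.ge rfl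
    refine .inr ⟨w, hmem.2, ?_⟩
    rw [← hw, Set.insert_sdiff_singleton, Set.insert_eq_of_mem ((G.mem_neighborSet u v).2 huv)]
  · exact .inl hw

theorem IsEdgeRobust.neighborSet_left_inter_nonempty (h : IsEdgeRobust G) (hxy : x ≠ y)
    (hC : IsCutComponent G x y C) : (G.neighborSet x ∩ C).Nonempty := by
  by_contra! hempty
  refine hC.left_notMem (subset_of_connected_induce (h.connected_compl_singleton y) ?_ ?_ hxy)
  · obtain ⟨u, hu⟩ := nonempty_of_connected_induce hC.connected
    exact ⟨u, ne_of_mem_of_not_mem hu hC.right_notMem, hu⟩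
  · rintro u ⟨-, hu⟩ v hvy huv
    exact hC.mem_of_adj hu huv (fun hvx => hempty.le ⟨hvx ▸ huv.symm, hu⟩) hvy

theorem IsEdgeRobust.neighborSet_right_inter_nonempty (h : IsEdgeRobust G) (hxy : x ≠ y)
    (hC : IsCutComponent G x y C) : (G.neighborSet y ∩ C).Nonempty :=
  h.neighborSet_left_inter_nonempty hxy.symm hC.symm

theorem IsEdgeRobust.exists_adj_left_notMem (h : IsEdgeRobust G) (hC : IsCutComponent G x y C)
    (hv : v ≠ x ∧ v ≠ y ∧ v ∉ C) (hxy : x ≠ y) : ∃ d ∉ C, d ≠ y ∧ G.Adj x d := by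
  by_contra! hd
  refine hv.2.2 (((subset_of_connected_induce (T := insert x C) (h.connected_compl_singleton y)
    ⟨x, hxy, .inl rfl⟩ ?_) hv.2.1).resolve_left hv.1)
  rintro u ⟨-, rfl | hu⟩ w hwy huw
  · exact .inr (by_contra fun hw => hd w hw hwy huw)
  · by_cases hwx : w = x
    · exact .inl hwx
    · exact .inr (hC.mem_of_adj hu huw hwx hwy)

end EdgeRobust

section Model

variable {H : SimpleGraph W} {H' : SimpleGraph W'} {G : SimpleGraph V} {B : W → Set V}

/-- `B` is a family of branch sets exhibiting `H` as a minor of `G`. -/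
structure IsModel (H : SimpleGraph W) (G : SimpleGraph V) (B : W → Set V) : Prop where
  connected : ∀ w, (G.induce (B w)).Connected
  disjoint : ∀ w w', w ≠ w' → Disjoint (B w) (B w')
  exists_adj : ∀ w w', H.Adj w w' → ∃ p ∈ B w, ∃ q ∈ B w', G.Adj p q

theorem isMinor_iff_exists_isModel : H.IsMinor G ↔ ∃ B, IsModel H G B :=
  exists_congr fun _ => ⟨fun ⟨h₁, h₂, h₃⟩ => ⟨h₁, h₂, h₃⟩, fun ⟨h₁, h₂, h₃⟩ => ⟨h₁, h₂, h₃⟩⟩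

theorem IsModel.nonempty (h : IsModel H G B) (w : W) : (B w).Nonempty :=
  nonempty_of_connected_induce (h.connected w)

theorem IsModel.eq_of_mem (h : IsModel H G B) {w w' : W} {v : V} (hw : v ∈ B w)
    (hw' : v ∈ B w') : w = w' :=
  by_contra fun hne => (h.disjoint w w' hne).notMem_of_mem_left hw hw'

theorem IsModel.comp (h : IsModel H G B) (f : H' ↪g H) : IsModel H' G (B ∘ f) where
  connected _ := h.connected _
  disjoint _ _ hne := h.disjoint _ _ (f.injective.ne hne)
  exists_adj _ _ hadj := h.exists_adj _ _ (f.map_adj_iff.2 hadj)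

theorem IsModel.map_iso {G' : SimpleGraph V'} (h : IsModel H G B) (e : G ≃g G') :
    IsModel H G' (fun w => e.symm ⁻¹' B w) where
  connected w := (connected_induce_preimage_iff e.symm).2 (h.connected w)
  disjoint _ _ hne := (h.disjoint _ _ hne).preimage _
  exists_adj w w' hadj := by
    obtain ⟨p, hp, q, hq, hpq⟩ := h.exists_adj w w' hadj
    exact ⟨e p, by simpa using hp, e q, by simpa using hq, e.map_adj_iff.2 hpq⟩

theorem isMinor_congr {G' : SimpleGraph V'} (e : G ≃g G') : H.IsMinor G ↔ H.IsMinor G' := by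
  simp only [isMinor_iff_exists_isModel]
  exact ⟨fun ⟨_, hB⟩ => ⟨_, hB.map_iso e⟩, fun ⟨_, hB⟩ => ⟨_, hB.map_iso e.symm⟩⟩

theorem IsModel.card_le [Fintype W] [Fintype V] (h : IsModel H G B) :
    Fintype.card W ≤ Fintype.card V := by
  choose f hf using h.nonempty
  exact Fintype.card_le_of_injective f fun w w' hww' => h.eq_of_mem (hf w) (hww' ▸ hf w')

theorem IsModel.disjoint_of_adj (hB : IsModel H G B) {x y : V} {C : Set V} {w w' : W}
    (hC : IsCutComponent G x y C) (hxw : x ∉ B w) (hyw : y ∉ B w) (hxw' : x ∉ B w')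
    (hyw' : y ∉ B w') (hww' : H.Adj w w') (hdisj : Disjoint (B w') C) : Disjoint (B w) C := by
  by_contra hne
  rw [Set.not_disjoint_iff_nonempty_inter] at hne
  obtain ⟨p, hp, q, hq, hpq⟩ := hB.exists_adj w w' hww'
  have hpC : p ∈ C := hC.subset_of_connected (hB.connected w) hxw hyw hne hp
  exact hdisj.notMem_of_mem_left hq
    (hC.subset_of_adj (hB.connected w') hxw' hyw' hpC hq hpq hq)

section Reroute

variable {x y : V} {C : Set V} {r s w₀ : W}

theorem IsModel.notMem_of_adj (hB : IsModel H G B) (hC : IsCutComponent G x y C)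
    (hx : x ∈ B r) (hy : y ∈ B s) (hrs : ¬ H.Adj r s)
    (hdisj : ∀ w, w ≠ w₀ → w ≠ r → w ≠ s → Disjoint (B w) C) {w w' : W} (hw : w ≠ w₀)
    (hw' : w' ≠ w₀) (hww' : H.Adj w w') {p q : V} (hp : p ∈ B w) (hq : q ∈ B w')
    (hpq : G.Adj p q) : p ∉ C := by
  intro hpC
  have eq_or_eq : ∀ {z v}, z ≠ w₀ → v ∈ B z → v ∈ C → z = r ∨ z = s := fun hz hv hvC => by
    by_contra! hne
    exact (hdisj _ hz hne.1 hne.2).notMem_of_mem_left hv hvC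
  have hw's : w' = r ∨ w' = s := by
    by_cases hqx : q = x
    · exact .inl (hB.eq_of_mem hq (hqx ▸ hx))
    by_cases hqy : q = y
    · exact .inr (hB.eq_of_mem hq (hqy ▸ hy))
    · exact eq_or_eq hw' hq (hC.mem_of_adj hpC hpq hqx hqy)
  obtain rfl | rfl := eq_or_eq hw hp hpC <;> obtain rfl | rfl := hw's
  exacts [hww'.ne rfl, hrs hww', hrs hww'.symm, hww'.ne rfl]

theorem IsModel.connected_sdiff (hB : IsModel H G B) (hC : IsCutComponent G x y C)
    (hx : x ∈ B r) (hy : y ∈ B s) (hne : r ≠ s)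
    (hdisj : ∀ w, w ≠ w₀ → w ≠ r → w ≠ s → Disjoint (B w) C) {w : W} (hw : w ≠ w₀) :
    (G.induce (B w \ C)).Connected := by
  by_cases hwr : w = r
  · exact hC.connected_sdiff (hB.connected w) (hwr ▸ hx)
      fun hyw => hne (hwr.symm.trans (hB.eq_of_mem hyw hy))
  by_cases hws : w = s
  · exact hC.symm.connected_sdiff (hB.connected w) (hws ▸ hy)
      fun hxw => hwr (hB.eq_of_mem hxw hx)
  · rw [(hdisj w hw hwr hws).sdiff_eq_left]
    exact hB.connected w

theorem IsModel.reroute [DecidableEq W] (hB : IsModel H G B) (hC : IsCutComponent G x y C)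
    (hxC : (G.neighborSet x ∩ C).Nonempty) (hyC : (G.neighborSet y ∩ C).Nonempty)
    (hx : x ∈ B r) (hy : y ∈ B s) (hne : r ≠ s) (hrs : ¬ H.Adj r s)
    (hw₀ : H.neighborSet w₀ ⊆ {r, s})
    (hdisj : ∀ w, w ≠ w₀ → w ≠ r → w ≠ s → Disjoint (B w) C) :
    IsModel H G (Function.update (fun w => B w \ C) w₀ C) := by
  have exists_adj₀ : ∀ w, H.Adj w₀ w → ∃ p ∈ C, ∃ q ∈ B w \ C, G.Adj p q := by
    intro w hw
    obtain rfl | rfl := hw₀ hw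
    · obtain ⟨d, hxd, hd⟩ := hxC
      exact ⟨d, hd, x, ⟨hx, hC.left_notMem⟩, hxd.symm⟩
    · obtain ⟨d, hyd, hd⟩ := hyC
      exact ⟨d, hd, y, ⟨hy, hC.right_notMem⟩, hyd.symm⟩
  refine ⟨fun w => ?_, fun w w' hww' => ?_, fun w w' hww' => ?_⟩
  · by_cases hw : w = w₀
    · rw [hw, Function.update_self]
      exact hC.connected
    rw [Function.update_of_ne hw]
    exact hB.connected_sdiff hC hx hy hne hdisj hw
  · by_cases hw : w = w₀
    · rw [hw, Function.update_self, Function.update_of_ne (hw ▸ hww'.symm)]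
      exact Set.disjoint_sdiff_right
    by_cases hw' : w' = w₀
    · rw [hw', Function.update_self, Function.update_of_ne hw]
      exact Set.disjoint_sdiff_left
    · rw [Function.update_of_ne hw, Function.update_of_ne hw']
      exact (hB.disjoint w w' hww').mono Set.sdiff_subset Set.sdiff_subset
  · by_cases hw : w = w₀
    · rw [hw, Function.update_self, Function.update_of_ne (hw ▸ hww'.ne')]
      exact exists_adj₀ w' (hw ▸ hww')
    by_cases hw' : w' = w₀
    · rw [hw', Function.update_self, Function.update_of_ne hw]
      obtain ⟨p, hp, q, hq, hpq⟩ := exists_adj₀ w (hw' ▸ hww'.symm)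
      exact ⟨q, hq, p, hp, hpq.symm⟩
    rw [Function.update_of_ne hw, Function.update_of_ne hw']
    obtain ⟨p, hp, q, hq, hpq⟩ := hB.exists_adj w w' hww'
    exact ⟨p, ⟨hp, hB.notMem_of_adj hC hx hy hrs hdisj hw hw' hww' hp hq hpq⟩,
      q, ⟨hq, hB.notMem_of_adj hC hx hy hrs hdisj hw' hw hww'.symm hq hp hpq.symm⟩, hpq⟩

end Reroute

end Model

section DoubleSubdivision

variable {G : SimpleGraph V} {a b c : V}

@[simp]
theorem doubleSubdivision_adj_inl_inl {p q : V} :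
    (G.doubleSubdivision a b).Adj (.inl p) (.inl q) ↔ G.Adj p q ∧ s(p, q) ≠ s(a, b) := by
  simp [doubleSubdivision]

@[simp]
theorem doubleSubdivision_adj_inl_inr {p : V} {i : Fin 2} :
    (G.doubleSubdivision a b).Adj (.inl p) (.inr i) ↔ p = a ∨ p = b :=
  Iff.rfl

@[simp]
theorem doubleSubdivision_adj_inr_inl {p : V} {i : Fin 2} :
    (G.doubleSubdivision a b).Adj (.inr i) (.inl p) ↔ p = a ∨ p = b :=
  Iff.rfl

@[simp]
theorem not_doubleSubdivision_adj_inr_inr {i j : Fin 2} :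
    ¬ (G.doubleSubdivision a b).Adj (.inr i) (.inr j) :=
  id

instance [DecidableEq V] [DecidableRel G.Adj] : DecidableRel (G.doubleSubdivision a b).Adj
  | .inl _, .inl _ => decidable_of_iff' _ doubleSubdivision_adj_inl_inl
  | .inl _, .inr _ => decidable_of_iff' _ doubleSubdivision_adj_inl_inr
  | .inr _, .inl _ => decidable_of_iff' _ doubleSubdivision_adj_inr_inl
  | .inr _, .inr _ => isFalse not_doubleSubdivision_adj_inr_inr

theorem doubleSubdivision_comm (G : SimpleGraph V) (a b : V) :
    G.doubleSubdivision a b = G.doubleSubdivision b a := by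
  ext (p | p) (q | q) <;> simp [or_comm, Sym2.eq_swap]

/-- The isomorphism of double subdivisions induced by an isomorphism of graphs. -/
def doubleSubdivisionCongr {G' : SimpleGraph V'} (e : G ≃g G') (a b : V) :
    G.doubleSubdivision a b ≃g G'.doubleSubdivision (e a) (e b) where
  toEquiv := e.toEquiv.sumCongr (.refl _)
  map_rel_iff' := by rintro (p | p) (q | q) <;> simp [e.map_adj_iff]

theorem neighborSet_inr (i : Fin 2) :
    (G.doubleSubdivision a b).neighborSet (.inr i) = {.inl a, .inl b} := by
  ext (q | j) <;> simp

theorem neighborSet_inl_of_ne {s : V} (hsa : s ≠ a) (hsb : s ≠ b) :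
    (G.doubleSubdivision a b).neighborSet (.inl s) = Sum.inl '' G.neighborSet s := by
  ext (q | j) <;> simp [hsa, hsb]

theorem neighborSet_inl_left (ha : G.neighborSet a = {b, c}) (hcb : c ≠ b) :
    (G.doubleSubdivision a b).neighborSet (.inl a) = {.inl c, .inr 0, .inr 1} := by
  ext (q | j)
  · have hq : G.Adj a q ↔ q = b ∨ q = c := by rw [← mem_neighborSet, ha]; simp
    simp only [mem_neighborSet, doubleSubdivision_adj_inl_inl, hq]
    grind
  · fin_cases j <;> simp

theorem connected_induce_doubleSubdivision {S : Set V} {U : Set (V ⊕ Fin 2)}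
    (h : (G.induce S).Connected) (hS : Sum.inl ⁻¹' U = S)
    (hinr : ∀ i, Sum.inr i ∈ U → Sum.inl a ∈ U ∨ Sum.inl b ∈ U)
    (hinl : Sum.inl a ∈ U → Sum.inl b ∈ U → ∃ i, Sum.inr i ∈ U) :
    ((G.doubleSubdivision a b).induce U).Connected := by
  subst hS
  obtain ⟨x, hx⟩ := nonempty_of_connected_induce h
  refine connected_induce_iff_forall_closed.2 ⟨⟨_, hx⟩, fun T ⟨t, htU, htT⟩ hT => ?_⟩
  have adj_mem : ∀ {u v}, u ∈ T → u ∈ U → v ∈ U → (G.doubleSubdivision a b).Adj u v → v ∈ T :=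
    fun huT hu hv huv => hT _ ⟨hu, huT⟩ _ hv huv
  have inl_mem : ∀ v, Sum.inl v ∈ U → Sum.inl v ∈ T := by
    refine subset_of_connected_induce (T := Sum.inl ⁻¹' T) h ?_ ?_
    · obtain t | i := t
      · exact ⟨t, htU, htT⟩
      · obtain ha | hb := hinr i htU
        · exact ⟨a, ha, adj_mem htT htU ha (by simp)⟩
        · exact ⟨b, hb, adj_mem htT htU hb (by simp)⟩
    · rintro u ⟨hu, huT⟩ v hv huv
      by_cases hs : s(u, v) = s(a, b)
      · obtain ⟨i, hi⟩ : ∃ i, Sum.inr i ∈ U := by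
          obtain ⟨rfl, rfl⟩ | ⟨rfl, rfl⟩ := Sym2.eq_iff.1 hs
          exacts [hinl hu hv, hinl hv hu]
        have hends : (u = a ∨ u = b) ∧ (v = a ∨ v = b) := by grind [Sym2.eq_iff]
        exact adj_mem (adj_mem huT hu hi hends.1) hi hv hends.2
      · exact adj_mem huT hu hv (doubleSubdivision_adj_inl_inl.2 ⟨huv, hs⟩)
  rintro (v | i) hv
  · exact inl_mem v hv
  · obtain ha | hb := hinr i hv
    · exact adj_mem (inl_mem a ha) ha hv (by simp)
    · exact adj_mem (inl_mem b hb) hb hv (by simp)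

theorem connected_induce_image_inl {S : Set V} (h : (G.induce S).Connected)
    (hS : a ∉ S ∨ b ∉ S) : ((G.doubleSubdivision a b).induce (Sum.inl '' S)).Connected := by
  refine connected_induce_doubleSubdivision h (Set.preimage_image_eq _ Sum.inl_injective) (by simp)
    fun ha hb => ?_
  simp only [Set.mem_image, Sum.inl.injEq, exists_eq_right] at ha hb
  exact (hS.elim (· ha) (· hb)).elim

/-- The vertex set in `G.doubleSubdivision a b` that corresponds to `S`: a new vertex belongs to it
as soon as one of its neighbours `a` and `b` does. Connectedness, and being a component of the
complement of two old vertices, pass from `S` to this set. -/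
def extendSet (a b : V) (S : Set V) : Set (V ⊕ Fin 2) :=
  {x | x.elim (· ∈ S) fun _ => a ∈ S ∨ b ∈ S}

@[simp]
theorem inl_mem_extendSet {S : Set V} {v : V} : Sum.inl v ∈ extendSet a b S ↔ v ∈ S :=
  Iff.rfl

@[simp]
theorem inr_mem_extendSet {S : Set V} {i : Fin 2} :
    Sum.inr i ∈ extendSet a b S ↔ a ∈ S ∨ b ∈ S :=
  Iff.rfl

theorem connected_induce_extendSet {S : Set V} (h : (G.induce S).Connected) :
    ((G.doubleSubdivision a b).induce (extendSet a b S)).Connected :=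
  connected_induce_doubleSubdivision h rfl (fun _ => id) fun ha _ => ⟨0, .inl ha⟩

theorem connected_induce_preimage_inl {U : Set (V ⊕ Fin 2)} (hab : G.Adj a b)
    (h : ((G.doubleSubdivision a b).induce U).Connected) (hne : (Sum.inl ⁻¹' U).Nonempty) :
    (G.induce (Sum.inl ⁻¹' U)).Connected := by
  refine connected_induce_iff_forall_closed.2 ⟨hne, fun T ⟨t, ht⟩ hT v hv => ?_⟩
  refine inl_mem_extendSet.1 (subset_of_connected_induce (T := extendSet a b (Sum.inl ⁻¹' U ∩ T)) h
    ⟨.inl t, ht.1, ht⟩ ?_ hv) |>.2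
  rintro (u | i) ⟨-, hu'⟩ (w | j) hw huw
  · exact ⟨hw, hT u hu' w hw (doubleSubdivision_adj_inl_inl.1 huw).1⟩
  · obtain rfl | rfl := doubleSubdivision_adj_inl_inr.1 huw
    exacts [.inl hu', .inr hu']
  · obtain rfl | rfl := doubleSubdivision_adj_inr_inl.1 huw
    · exact hu'.elim id fun hb => ⟨hw, hT b hb w hw hab.symm⟩
    · exact hu'.elim (fun ha => ⟨hw, hT a ha w hw hab⟩) id
  · exact (not_doubleSubdivision_adj_inr_inr huw).elim

theorem isCutComponent_singleton_inr (i : Fin 2) :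
    IsCutComponent (G.doubleSubdivision a b) (.inl a) (.inl b) {.inr i} :=
  isCutComponent_singleton (neighborSet_inr i)

theorem eq_singleton_inr_of_notMem {U : Set (V ⊕ Fin 2)} {i : Fin 2}
    (hU : ((G.doubleSubdivision a b).induce U).Connected) (hi : Sum.inr i ∈ U)
    (ha : Sum.inl a ∉ U) (hb : Sum.inl b ∉ U) : U = {Sum.inr i} :=
  ((isCutComponent_singleton_inr i).subset_of_connected hU ha hb ⟨_, hi, rfl⟩).antisymm
    (Set.singleton_subset_iff.2 hi)

theorem mem_or_mem_of_connected_induce {U : Set (V ⊕ Fin 2)} {i : Fin 2}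
    (hU : ((G.doubleSubdivision a b).induce U).Connected) (hne : (Sum.inl ⁻¹' U).Nonempty)
    (hi : Sum.inr i ∈ U) : Sum.inl a ∈ U ∨ Sum.inl b ∈ U := by
  by_contra! h
  obtain ⟨v, hv⟩ := hne
  rw [eq_singleton_inr_of_notMem hU hi h.1 h.2] at hv
  exact Sum.inl_ne_inr hv

theorem IsCutComponent.extendSet {x y : V} {C : Set V} (h : IsCutComponent G x y C)
    (hab : G.Adj a b) :
    IsCutComponent (G.doubleSubdivision a b) (.inl x) (.inl y) (extendSet a b C) where
  connected := connected_induce_extendSet h.connected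
  left_notMem := h.left_notMem
  right_notMem := h.right_notMem
  mem_of_adj := by
    have mem_of_adj' : ∀ {u v}, u ∈ C → G.Adj u v → (.inl v : V ⊕ Fin 2) ≠ .inl x →
        (.inl v : V ⊕ Fin 2) ≠ .inl y → v ∈ C := fun hu huv hvx hvy =>
      h.mem_of_adj hu huv (ne_of_apply_ne _ hvx) (ne_of_apply_ne _ hvy)
    rintro (u | i) (v | j) hu huv hvx hvy
    · exact mem_of_adj' hu (doubleSubdivision_adj_inl_inl.1 huv).1 hvx hvy
    · obtain rfl | rfl := doubleSubdivision_adj_inl_inr.1 huv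
      exacts [.inl hu, .inr hu]
    · obtain rfl | rfl := doubleSubdivision_adj_inr_inl.1 huv
      · exact hu.elim id fun hb => mem_of_adj' hb hab.symm hvx hvy
      · exact hu.elim (fun ha => mem_of_adj' ha hab hvx hvy) id
    · exact (not_doubleSubdivision_adj_inr_inr huv).elim

theorem IsCutComponent.disjoint_extendSet {x y : V} {C D : Set V} (hC : IsCutComponent G x y C)
    (hab : G.Adj a b) (hx : x ∉ D) (hy : y ∉ D) (hCD : Disjoint C D) :
    Disjoint (GeneralisedTriangle.extendSet a b C) (GeneralisedTriangle.extendSet a b D) := by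
  have notMem_of_adj : ∀ {u v}, u ∈ C → G.Adj u v → v ∉ D := fun hu huv hv =>
    hCD.notMem_of_mem_left (hC.mem_of_adj hu huv (ne_of_mem_of_not_mem hv hx)
      (ne_of_mem_of_not_mem hv hy)) hv
  rw [Set.disjoint_left]
  rintro (v | i) hv
  · exact hCD.notMem_of_mem_left hv
  · rintro (ha | hb) <;> obtain ha' | hb' := hv
    · exact hCD.notMem_of_mem_left ha' ha
    · exact notMem_of_adj hb' hab.symm ha
    · exact notMem_of_adj ha' hab hb
    · exact hCD.notMem_of_mem_left hb' hb

theorem IsEdgeRobust.doubleSubdivision (h : IsEdgeRobust G) (hab : G.Adj a b) :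
    IsEdgeRobust (G.doubleSubdivision a b) := by
  have hne := hab.ne
  have hG : (G.induce Set.univ).Connected := (induceUnivIso G).connected_iff.2 h.connected
  have connected_compl_inl_inr : ∀ (u : V) (j : Fin 2), u = a ∨ u = b →
      ((G.doubleSubdivision a b).induce {Sum.inl u, Sum.inr j}ᶜ).Connected := fun u j hu =>
    connected_induce_doubleSubdivision (h.connected_compl_singleton u) (by ext; simp) (by grind)
      fun _ _ => ⟨j + 1, by simp⟩
  refine ⟨?_, ?_, ?_⟩
  · refine (induceUnivIso _).connected_iff.1 ?_
    exact connected_induce_doubleSubdivision hG rfl (by simp) fun _ _ => ⟨0, trivial⟩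
  · rintro (v | i)
    · exact connected_induce_doubleSubdivision (h.connected_compl_singleton v) (by ext; simp)
        (by grind) fun _ _ => ⟨0, by simp⟩
    · exact connected_induce_doubleSubdivision hG (by ext; simp) (by simp)
        fun _ _ => ⟨i + 1, by simp⟩
  · rintro (u | i) (v | j) huv
    · obtain ⟨huv, hs⟩ := doubleSubdivision_adj_inl_inl.1 huv
      exact connected_induce_doubleSubdivision (h.connected_compl_pair huv) (by ext; simp)
        (by grind) fun _ _ => ⟨0, by simp⟩
    · exact connected_compl_inl_inr u j huv
    · rw [Set.pair_comm]
      exact connected_compl_inl_inr v i huv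
    · exact (not_doubleSubdivision_adj_inr_inr huv).elim

end DoubleSubdivision

section DoubleSubdivisionModel

variable {H : SimpleGraph W} {G : SimpleGraph V} {a b : V}

/-- The branch set containing `a` or else the one containing `b` receives both new vertices. -/
theorem IsModel.exists_lift {B : W → Set V} (h : IsModel H G B) (a b : V) :
    ∃ B' : W → Set (V ⊕ Fin 2), IsModel H (G.doubleSubdivision a b) B' ∧
      ∀ w, Sum.inl ⁻¹' B' w = B w := by
  refine ⟨fun w => {x | x.elim (· ∈ B w) fun _ => a ∈ B w ∨ b ∈ B w ∧ ∀ w', a ∉ B w'},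
    ⟨fun w => ?_, fun w w' hww' => ?_, fun w w' hww' => ?_⟩, fun w => rfl⟩
  · exact connected_induce_doubleSubdivision (h.connected w) rfl (fun _ => .imp_right And.left)
      fun ha _ => ⟨0, .inl ha⟩
  · rw [Set.disjoint_left]
    rintro (v | i) hv hv'
    · exact hww' (h.eq_of_mem hv hv')
    · obtain ha | ⟨hb, hna⟩ := hv <;> obtain ha' | ⟨hb', hna'⟩ := hv'
      exacts [hww' (h.eq_of_mem ha ha'), hna' w ha, hna w' ha', hww' (h.eq_of_mem hb hb')]
  · obtain ⟨p, hp, q, hq, hpq⟩ := h.exists_adj w w' hww'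
    by_cases hs : s(p, q) = s(a, b)
    · obtain ⟨rfl, rfl⟩ | ⟨rfl, rfl⟩ := Sym2.eq_iff.1 hs
      · exact ⟨.inr 0, .inl hp, .inl q, hq, .inr rfl⟩
      · exact ⟨.inl p, hp, .inr 0, .inl hq, .inr rfl⟩
    · exact ⟨.inl p, hp, .inl q, hq, doubleSubdivision_adj_inl_inl.2 ⟨hpq, hs⟩⟩

theorem IsModel.doubleSubdivision {B : W → Set V} (h : IsModel H G B) {r s : W} (hrs : r ≠ s)
    (ha : a ∈ B r) (hb : b ∈ B s) :
    IsModel (H.doubleSubdivision r s) (G.doubleSubdivision a b)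
      (Sum.elim (fun w => Sum.inl '' B w) fun i => {Sum.inr i}) := by
  refine ⟨?_, ?_, ?_⟩
  · rintro (w | i)
    · refine connected_induce_image_inl (h.connected w) ?_
      by_contra! hab
      exact hrs ((h.eq_of_mem ha hab.1).trans (h.eq_of_mem hab.2 hb))
    · exact connected_induce_singleton _ _
  · rintro (w | i) (w' | j) hww'
    · exact (Set.disjoint_image_iff Sum.inl_injective).2
        (h.disjoint w w' (ne_of_apply_ne Sum.inl hww'))
    · simp
    · simp
    · simpa using hww'
  · rintro (w | i) (w' | j) hww'
    · obtain ⟨hww', hne⟩ := doubleSubdivision_adj_inl_inl.1 hww'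
      obtain ⟨p, hp, q, hq, hpq⟩ := h.exists_adj w w' hww'
      refine ⟨.inl p, ⟨p, hp, rfl⟩, .inl q, ⟨q, hq, rfl⟩,
        doubleSubdivision_adj_inl_inl.2 ⟨hpq, fun hs => hne ?_⟩⟩
      obtain ⟨rfl, rfl⟩ | ⟨rfl, rfl⟩ := Sym2.eq_iff.1 hs
      · rw [h.eq_of_mem hp ha, h.eq_of_mem hq hb]
      · rw [h.eq_of_mem hp hb, h.eq_of_mem hq ha, Sym2.eq_swap]
    · obtain rfl | rfl := doubleSubdivision_adj_inl_inr.1 hww'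
      · exact ⟨.inl a, ⟨a, ha, rfl⟩, .inr j, rfl, by simp⟩
      · exact ⟨.inl b, ⟨b, hb, rfl⟩, .inr j, rfl, by simp⟩
    · obtain rfl | rfl := doubleSubdivision_adj_inr_inl.1 hww'
      · exact ⟨.inr i, rfl, .inl a, ⟨a, ha, rfl⟩, by simp⟩
      · exact ⟨.inr i, rfl, .inl b, ⟨b, hb, rfl⟩, by simp⟩
    · exact (not_doubleSubdivision_adj_inr_inr hww').elim

theorem IsModel.of_doubleSubdivision {B : W → Set (V ⊕ Fin 2)}
    (h : IsModel H (G.doubleSubdivision a b) B) (hab : G.Adj a b)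
    (hne : ∀ w, (Sum.inl ⁻¹' B w).Nonempty) : IsModel H G fun w => Sum.inl ⁻¹' B w := by
  have exists_inl_adj : ∀ {w w' i v}, H.Adj w w' → Sum.inr i ∈ B w → Sum.inl v ∈ B w' →
      (v = a ∨ v = b) → ∃ u, Sum.inl u ∈ B w ∧ G.Adj u v := by
    intro w w' i v hww' hi hv hv'
    have hdisj := Set.disjoint_left.1 (h.disjoint w w' hww'.ne)
    have hu := mem_or_mem_of_connected_induce (h.connected w) (hne w) hi
    obtain rfl | rfl := hv' <;> obtain hu | hu := hu
    exacts [(hdisj hu hv).elim, ⟨b, hu, hab.symm⟩, ⟨a, hu, hab⟩, (hdisj hu hv).elim]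
  refine ⟨fun w => connected_induce_preimage_inl hab (h.connected w) (hne w),
    fun w w' hww' => (h.disjoint w w' hww').preimage _, fun w w' hww' => ?_⟩
  obtain ⟨p | i, hp, q | j, hq, hpq⟩ := h.exists_adj w w' hww'
  · exact ⟨p, hp, q, hq, (doubleSubdivision_adj_inl_inl.1 hpq).1⟩
  · obtain ⟨u, hu, hup⟩ := exists_inl_adj hww'.symm hq hp hpq
    exact ⟨p, hp, u, hu, hup.symm⟩
  · obtain ⟨u, hu, huq⟩ := exists_inl_adj hww' hp hq hpq
    exact ⟨u, hu, q, hq, huq⟩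
  · exact (not_doubleSubdivision_adj_inr_inr hpq).elim

end DoubleSubdivisionModel

section Split

variable {G : SimpleGraph V} {a b s y z : V} {E : Fin 2 → Set V}

/-- `E 0` and `E 1` are two different components of `G - {y, z}`, neither of them containing `s`.
In the applications `y` and `z` are the only neighbours of `s`, so that `{s}` is a third one. -/
structure IsSplit (G : SimpleGraph V) (s y z : V) (E : Fin 2 → Set V) : Prop where
  isCutComponent : ∀ k, IsCutComponent G y z (E k)
  notMem : ∀ k, s ∉ E k
  disjoint : ∀ {k l}, k ≠ l → Disjoint (E k) (E l)

theorem IsSplit.symm (h : IsSplit G s y z E) : IsSplit G s z y E :=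
  ⟨fun k => (h.isCutComponent k).symm, h.notMem, h.disjoint⟩

theorem IsSplit.exists_notMem (h : IsSplit G s y z E) (v : V) : ∃ k, v ∉ E k := by
  by_contra! hv
  exact (h.disjoint zero_ne_one).notMem_of_mem_left (hv 0) (hv 1)

theorem IsSplit.exists_disjoint_of_connected (h : IsSplit G s y z E) {S : Set V}
    (hS : (G.induce S).Connected) (hy : y ∉ S) (hz : z ∉ S) : ∃ k, Disjoint S (E k) := by
  obtain ⟨v, hv⟩ := nonempty_of_connected_induce hS
  obtain ⟨k, hk⟩ := h.exists_notMem v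
  refine ⟨k, by_contra fun hne => hk ?_⟩
  exact (h.isCutComponent k).subset_of_connected hS hy hz
    (Set.not_disjoint_iff_nonempty_inter.1 hne) hv

theorem IsSplit.extendSet (h : IsSplit G s y z E) (hab : G.Adj a b) :
    IsSplit (G.doubleSubdivision a b) (.inl s) (.inl y) (.inl z) fun k => extendSet a b (E k) where
  isCutComponent k := (h.isCutComponent k).extendSet hab
  notMem := h.notMem
  disjoint hkl := (h.isCutComponent _).disjoint_extendSet hab (h.isCutComponent _).left_notMem
    (h.isCutComponent _).right_notMem (h.disjoint hkl)

theorem isCutComponent_image_inl_compl (h : IsEdgeRobust G) (hab : G.Adj a b) :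
    IsCutComponent (G.doubleSubdivision a b) (.inl a) (.inl b) (Sum.inl '' {a, b}ᶜ) where
  connected := connected_induce_image_inl (h.connected_compl_pair hab) (.inl (by simp))
  left_notMem := by simp
  right_notMem := by simp
  mem_of_adj := by
    rintro _ (v | i) ⟨u, hu, rfl⟩ huv hva hvb
    · exact ⟨v, by simp_all, rfl⟩
    · exact (hu (doubleSubdivision_adj_inl_inr.1 huv)).elim

theorem isSplit_inr (h : IsEdgeRobust G) (hab : G.Adj a b) (i : Fin 2) :
    IsSplit (G.doubleSubdivision a b) (.inr i) (.inl a) (.inl b)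
      ![{.inr (i + 1)}, Sum.inl '' {a, b}ᶜ] where
  isCutComponent := Fin.forall_fin_two.2
    ⟨isCutComponent_singleton_inr _, isCutComponent_image_inl_compl h hab⟩
  notMem := Fin.forall_fin_two.2 ⟨by simp, by simp⟩
  disjoint {k l} hkl := by fin_cases k <;> fin_cases l <;> simp_all

theorem isSplit_singleton_inr (s : V) :
    IsSplit (G.doubleSubdivision a b) (.inl s) (.inl a) (.inl b) fun k => {.inr k} where
  isCutComponent := isCutComponent_singleton_inr
  notMem := by simp
  disjoint := by simp

/-- Deleting the neighbours of a vertex of degree two leaves at least two further components. -/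
def HasDegreeTwoSplits (G : SimpleGraph V) : Prop :=
  ∀ s y z, y ≠ z → G.neighborSet s = {y, z} → ∃ E, IsSplit G s y z E

theorem IsEdgeRobust.neighborSet_inl_left_ne_pair (h : IsEdgeRobust G) (hab : G.Adj a b)
    (p q : V ⊕ Fin 2) : (G.doubleSubdivision a b).neighborSet (.inl a) ≠ {p, q} := by
  intro hpq
  obtain ⟨d, hdb, had⟩ := h.exists_adj_ne hab
  have mem_pair : ∀ {r}, (G.doubleSubdivision a b).Adj (.inl a) r → r = p ∨ r = q :=
    fun hr => hpq.le hr
  have h₀ := mem_pair (r := .inr 0) (by simp)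
  have h₁ := mem_pair (r := .inr 1) (by simp)
  have hd := mem_pair (r := .inl d) (by simp [had, hdb, hab.ne])
  grind

theorem IsEdgeRobust.hasDegreeTwoSplits_doubleSubdivision (h : IsEdgeRobust G) (hab : G.Adj a b)
    (hG : ∀ s y z, s ≠ a → s ≠ b → y ≠ z → G.neighborSet s = {y, z} →
      s(y, z) = s(a, b) ∨ ∃ E, IsSplit G s y z E) :
    HasDegreeTwoSplits (G.doubleSubdivision a b) := by
  rintro (s | i) y z hyz hs
  · have hsa : s ≠ a := by
      rintro rfl
      exact h.neighborSet_inl_left_ne_pair hab y z hs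
    have hsb : s ≠ b := by
      rintro rfl
      rw [doubleSubdivision_comm] at hs
      exact h.neighborSet_inl_left_ne_pair hab.symm y z hs
    rw [neighborSet_inl_of_ne hsa hsb] at hs
    obtain ⟨y, -, rfl⟩ : y ∈ Sum.inl '' G.neighborSet s := hs ▸ .inl rfl
    obtain ⟨z, -, rfl⟩ : z ∈ Sum.inl '' G.neighborSet s := hs ▸ .inr rfl
    rw [← Set.image_pair] at hs
    obtain hyzab | ⟨E, hE⟩ := hG s y z hsa hsb (ne_of_apply_ne _ hyz)
      (Sum.inl_injective.image_injective hs)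
    · obtain ⟨rfl, rfl⟩ | ⟨rfl, rfl⟩ := Sym2.eq_iff.1 hyzab
      exacts [⟨_, isSplit_singleton_inr s⟩, ⟨_, (isSplit_singleton_inr s).symm⟩]
    · exact ⟨_, hE.extendSet hab⟩
  · rw [neighborSet_inr] at hs
    obtain ⟨rfl, rfl⟩ | ⟨rfl, rfl⟩ := Set.pair_eq_pair_iff.1 hs
    exacts [⟨_, isSplit_inr h hab i⟩, ⟨_, (isSplit_inr h hab i).symm⟩]

theorem HasDegreeTwoSplits.doubleSubdivision (hs : HasDegreeTwoSplits G) (h : IsEdgeRobust G)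
    (hab : G.Adj a b) : HasDegreeTwoSplits (G.doubleSubdivision a b) :=
  h.hasDegreeTwoSplits_doubleSubdivision hab fun s y z _ _ hyz hsN => .inr (hs s y z hyz hsN)

end Split

section RootedModel

variable {G : SimpleGraph V} {a b u v s y z : V} {E : Fin 2 → Set V}

/-- The graph formed from `K₃` by double subdividing the edges `01` and `12`. Double subdividing
its remaining old edge `02` gives `H0`. -/
def twoDoubled : SimpleGraph ((Fin 3 ⊕ Fin 2) ⊕ Fin 2) :=
  ((⊤ : SimpleGraph (Fin 3)).doubleSubdivision 0 1).doubleSubdivision (.inl 1) (.inl 2)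

/-- `twoDoubled` is a minor of `G` with `u` and `v` in the branch sets of the ends of the edge whose
double subdivision turns `twoDoubled` into `H0`. -/
def HasRootedModel (G : SimpleGraph V) (u v : V) : Prop :=
  ∃ B, IsModel twoDoubled G B ∧ u ∈ B (.inl (.inl 0)) ∧ v ∈ B (.inl (.inl 2))

/-- The automorphism of `twoDoubled` that exchanges the ends of the edge not yet subdivided. -/
def twoDoubledSwap : twoDoubled ↪g twoDoubled where
  toFun
    | .inl (.inl i) => .inl (.inl i.rev)
    | .inl (.inr k) => .inr k
    | .inr k => .inl (.inr k)
  inj' := by decide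
  map_rel_iff' := by
    unfold twoDoubled
    decide

theorem HasRootedModel.symm (h : HasRootedModel G u v) : HasRootedModel G v u := by
  obtain ⟨B, hB, hu, hv⟩ := h
  exact ⟨_, hB.comp twoDoubledSwap, hv, hu⟩

theorem HasRootedModel.lift (h : HasRootedModel G u v) (a b : V) :
    HasRootedModel (G.doubleSubdivision a b) (.inl u) (.inl v) := by
  obtain ⟨B, hB, hu, hv⟩ := h
  obtain ⟨B', hB', hB'B⟩ := hB.exists_lift a b
  rw [← hB'B] at hu hv
  exact ⟨B', hB', hu, hv⟩

theorem HasRootedModel.isMinor_doubleSubdivision (h : HasRootedModel G u v) :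
    H0.IsMinor (G.doubleSubdivision u v) := by
  obtain ⟨B, hB, hu, hv⟩ := h
  exact isMinor_iff_exists_isModel.2 ⟨_, hB.doubleSubdivision (by decide) hu hv⟩

theorem IsSplit.isModel (hE : IsSplit G s y z E) (h : IsEdgeRobust G) (hyz : y ≠ z)
    (hs : G.neighborSet s = {y, z}) :
    IsModel ((⊤ : SimpleGraph (Fin 3)).doubleSubdivision 0 1) G
      (Sum.elim (fun i => {![y, z, s] i}) E) := by
  have hsy : G.Adj s y := hs.ge (by simp)
  have hsz : G.Adj s z := hs.ge (by simp)
  have hinj : Function.Injective ![y, z, s] := by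
    have := hsy.ne
    have := hsz.ne
    intro i j
    fin_cases i <;> fin_cases j <;> simp_all [eq_comm]
  have notMem : ∀ (i : Fin 3) k, ![y, z, s] i ∉ E k := fun i k => by
    fin_cases i
    exacts [(hE.isCutComponent k).left_notMem, (hE.isCutComponent k).right_notMem, hE.notMem k]
  have adj_old : ∀ i j : Fin 3, i ≠ j → s(i, j) ≠ s(0, 1) →
      G.Adj (![y, z, s] i) (![y, z, s] j) := by
    intro i j
    fin_cases i <;> fin_cases j <;> simp [hsy, hsz, hsy.symm, hsz.symm]
  have exists_adj_new : ∀ (i : Fin 3) k, i = 0 ∨ i = 1 → ∃ q ∈ E k, G.Adj (![y, z, s] i) q := by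
    rintro i k (rfl | rfl)
    · obtain ⟨q, hq, hqE⟩ := h.neighborSet_left_inter_nonempty hyz (hE.isCutComponent k)
      exact ⟨q, hqE, hq⟩
    · obtain ⟨q, hq, hqE⟩ := h.neighborSet_right_inter_nonempty hyz (hE.isCutComponent k)
      exact ⟨q, hqE, hq⟩
  refine ⟨?_, ?_, ?_⟩
  · rintro (i | k)
    exacts [connected_induce_singleton _ _, (hE.isCutComponent k).connected]
  · rintro (i | k) (j | l) hne
    · simpa using hinj.ne (ne_of_apply_ne Sum.inl hne)
    · simpa using notMem i l
    · simpa using notMem j k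
    · exact hE.disjoint (ne_of_apply_ne Sum.inr hne)
  · rintro (i | k) (j | l) hadj
    · obtain ⟨hij, hne⟩ := doubleSubdivision_adj_inl_inl.1 hadj
      exact ⟨_, rfl, _, rfl, adj_old i j hij hne⟩
    · exact ⟨_, rfl, exists_adj_new i l (doubleSubdivision_adj_inl_inr.1 hadj)⟩
    · obtain ⟨q, hq, hjq⟩ := exists_adj_new j k (doubleSubdivision_adj_inr_inl.1 hadj)
      exact ⟨q, hq, _, rfl, hjq.symm⟩
    · exact (not_doubleSubdivision_adj_inr_inr hadj).elim

theorem IsSplit.hasRootedModel (hE : IsSplit G s y z E) (h : IsEdgeRobust G) (hyz : y ≠ z)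
    (hs : G.neighborSet s = {y, z}) :
    HasRootedModel (G.doubleSubdivision z s) (.inl y) (.inl s) := by
  have hB := hE.isModel h hyz hs
  exact ⟨_, hB.doubleSubdivision (r := .inl 1) (s := .inl 2) (by decide) rfl rfl,
    ⟨y, rfl, rfl⟩, ⟨s, rfl, rfl⟩⟩

/-- Every edge both of whose ends have degree at least three carries a model of `twoDoubled` rooted
at its ends, so that double subdividing it creates an `H0`-minor. -/
def ThickEdgesRooted (G : SimpleGraph V) : Prop :=
  ∀ u v, G.Adj u v → (G.neighborSet u \ {v}).Nontrivial → (G.neighborSet v \ {u}).Nontrivial →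
    HasRootedModel G u v

theorem not_nontrivial_neighborSet_inr_sdiff (i : Fin 2) (hu : u = a ∨ u = b) :
    ¬ ((G.doubleSubdivision a b).neighborSet (.inr i) \ {.inl u}).Nontrivial := by
  rw [Set.not_nontrivial_iff, neighborSet_inr]
  rintro p ⟨hp, hpu⟩ q ⟨hq, hqu⟩
  grind

theorem HasDegreeTwoSplits.nontrivial_or_hasRootedModel (hs : HasDegreeTwoSplits G)
    (h : IsEdgeRobust G) (hab : G.Adj a b)
    (huv : (G.doubleSubdivision a b).Adj (.inl u) (.inl v))
    (hu : ((G.doubleSubdivision a b).neighborSet (.inl u) \ {.inl v}).Nontrivial) :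
    (G.neighborSet u \ {v}).Nontrivial ∨
      HasRootedModel (G.doubleSubdivision a b) (.inl u) (.inl v) := by
  obtain ⟨huv, hne⟩ := doubleSubdivision_adj_inl_inl.1 huv
  refine (h.nontrivial_or_neighborSet_eq_pair huv).imp_right ?_
  rintro ⟨c, hcv, hN⟩
  obtain ⟨E, hE⟩ := hs u v c hcv.symm hN
  have hrooted := (hE.hasRootedModel h hcv.symm hN).symm
  have eq_of_adj : ∀ {w}, G.Adj u w → w ≠ v → w = c := fun hw hwv => (hN.le hw).resolve_left hwv
  by_cases hua : u = a
  · subst hua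
    obtain rfl : b = c := eq_of_adj hab (by grind)
    rwa [doubleSubdivision_comm]
  by_cases hub : u = b
  · subst hub
    obtain rfl : a = c := eq_of_adj hab.symm (by grind)
    exact hrooted
  · rw [neighborSet_inl_of_ne hua hub, hN, Set.image_pair] at hu
    obtain ⟨p, ⟨hp, hpv⟩, q, ⟨hq, hqv⟩, hpq⟩ := hu
    grind

theorem ThickEdgesRooted.doubleSubdivision (hr : ThickEdgesRooted G) (hs : HasDegreeTwoSplits G)
    (h : IsEdgeRobust G) (hab : G.Adj a b) : ThickEdgesRooted (G.doubleSubdivision a b) := by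
  rintro (u | i) (v | j) huv hu hv
  · obtain hu | hrooted := hs.nontrivial_or_hasRootedModel h hab huv hu
    · obtain hv | hrooted := hs.nontrivial_or_hasRootedModel h hab huv.symm hv
      · exact (hr u v (doubleSubdivision_adj_inl_inl.1 huv).1 hu hv).lift a b
      · exact hrooted.symm
    · exact hrooted
  · exact (not_nontrivial_neighborSet_inr_sdiff j (doubleSubdivision_adj_inl_inr.1 huv) hv).elim
  · exact (not_nontrivial_neighborSet_inr_sdiff i (doubleSubdivision_adj_inr_inl.1 huv) hu).elim
  · exact (not_doubleSubdivision_adj_inr_inr huv).elim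

end RootedModel

section ThickCut

variable {G : SimpleGraph V} {x y : V} {C : Set V}

/-- `C` is a component of the disconnected graph `G - {x, y}` containing at least two neighbours
of `x` and at least two neighbours of `y`: the corresponding bridge violates property `P₁`. -/
structure IsThickCut (G : SimpleGraph V) (x y : V) (C : Set V) : Prop
    extends IsCutComponent G x y C where
  ne : x ≠ y
  exists_notMem : ∃ v, v ≠ x ∧ v ≠ y ∧ v ∉ C
  left_nontrivial : (G.neighborSet x ∩ C).Nontrivial
  right_nontrivial : (G.neighborSet y ∩ C).Nontrivial

/-- Some 2-cut of `G` has a bridge violating property `P₁`. -/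
def HasThickCut (G : SimpleGraph V) : Prop :=
  ∃ x y C, IsThickCut G x y C

theorem IsThickCut.symm (h : IsThickCut G x y C) : IsThickCut G y x C where
  toIsCutComponent := h.toIsCutComponent.symm
  ne := h.ne.symm
  exists_notMem := h.exists_notMem.imp fun _ hv => ⟨hv.2.1, hv.1, hv.2.2⟩
  left_nontrivial := h.right_nontrivial
  right_nontrivial := h.left_nontrivial

theorem IsThickCut.map_iso {G' : SimpleGraph V'} (h : IsThickCut G x y C) (e : G ≃g G') :
    IsThickCut G' (e x) (e y) (e.symm ⁻¹' C) where
  toIsCutComponent := h.toIsCutComponent.map_iso e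
  ne := e.injective.ne h.ne
  exists_notMem := by
    obtain ⟨v, hvx, hvy, hvC⟩ := h.exists_notMem
    exact ⟨e v, e.injective.ne hvx, e.injective.ne hvy, by simpa using hvC⟩
  left_nontrivial := by
    have himage : (G.neighborSet x ∩ C).image e ⊆ G'.neighborSet (e x) ∩ e.symm ⁻¹' C := by
      rintro _ ⟨v, hv, rfl⟩
      exact ⟨e.map_adj_iff.2 hv.1, by simpa using hv.2⟩
    exact (h.left_nontrivial.image e.injective).mono himage
  right_nontrivial := by
    have himage : (G.neighborSet y ∩ C).image e ⊆ G'.neighborSet (e y) ∩ e.symm ⁻¹' C := by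
      rintro _ ⟨v, hv, rfl⟩
      exact ⟨e.map_adj_iff.2 hv.1, by simpa using hv.2⟩
    exact (h.right_nontrivial.image e.injective).mono himage

theorem IsThickCut.neighborSet_left_ne_pair (hC : IsThickCut G x y C) (h : IsEdgeRobust G)
    (p q : V) : G.neighborSet x ≠ {p, q} := by
  intro hpq
  obtain ⟨u, ⟨hxu, huC⟩, v, ⟨hxv, hvC⟩, huv⟩ := hC.left_nontrivial
  obtain ⟨w, hw⟩ := hC.exists_notMem
  obtain ⟨d, hdC, -, hxd⟩ := h.exists_adj_left_notMem hC.toIsCutComponent hw hC.ne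
  have mem_pair : ∀ {z}, G.Adj x z → z = p ∨ z = q := fun hz => hpq.le hz
  grind [mem_pair hxu, mem_pair hxv, mem_pair hxd]

theorem IsSplit.exists_subset_of_mem {s p q : V} {E : Fin 2 → Set V} (hE : IsSplit G s p q E)
    (h : IsEdgeRobust G) (hpq : p ≠ q) (hC : IsCutComponent G x y C) (hx : ∀ k, x ∉ E k)
    (hp : p ∈ C) : ∃ k, E k ⊆ C := by
  obtain ⟨k, hk⟩ := hE.exists_notMem y
  obtain ⟨d, hpd, hd⟩ := h.neighborSet_left_inter_nonempty hpq (hE.isCutComponent k)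
  exact ⟨k, hC.subset_of_adj (hE.isCutComponent k).connected (hx k) hk hp hd hpd⟩

end ThickCut

section ThickCutDoubleSubdivision

variable {G : SimpleGraph V} {a b c x y : V}

theorem nontrivial_neighborSet_inter_extendSet {C : Set V}
    (h : (G.neighborSet x ∩ C).Nontrivial) :
    ((G.doubleSubdivision a b).neighborSet (.inl x) ∩ extendSet a b C).Nontrivial := by
  by_cases hab : (x = a ∨ x = b) ∧ (a ∈ C ∨ b ∈ C)
  · exact ⟨.inr 0, hab, .inr 1, hab, by simp⟩
  · refine (h.image Sum.inl_injective).mono ?_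
    rintro _ ⟨v, ⟨hxv, hv⟩, rfl⟩
    refine ⟨doubleSubdivision_adj_inl_inl.2 ⟨hxv, fun hs => hab ?_⟩, hv⟩
    obtain ⟨rfl, rfl⟩ | ⟨rfl, rfl⟩ := Sym2.eq_iff.1 hs
    exacts [⟨.inl rfl, .inr hv⟩, ⟨.inr rfl, .inl hv⟩]

theorem HasThickCut.doubleSubdivision (h : HasThickCut G) (hab : G.Adj a b) :
    HasThickCut (G.doubleSubdivision a b) := by
  obtain ⟨x, y, C, hC⟩ := h
  obtain ⟨v, hvx, hvy, hvC⟩ := hC.exists_notMem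
  exact ⟨.inl x, .inl y, extendSet a b C, hC.toIsCutComponent.extendSet hab,
    Sum.inl_injective.ne hC.ne,
    ⟨.inl v, Sum.inl_injective.ne hvx, Sum.inl_injective.ne hvy, hvC⟩,
    nontrivial_neighborSet_inter_extendSet hC.left_nontrivial,
    nontrivial_neighborSet_inter_extendSet hC.right_nontrivial⟩

theorem IsEdgeRobust.hasThickCut_doubleSubdivision (h : IsEdgeRobust G) (hab : G.Adj a b)
    (ha : (G.neighborSet a \ {b}).Nontrivial) (hb : (G.neighborSet b \ {a}).Nontrivial) :
    HasThickCut (G.doubleSubdivision a b) := by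
  refine ⟨.inl a, .inl b, _, isCutComponent_image_inl_compl h hab, Sum.inl_injective.ne hab.ne,
    ⟨.inr 0, by simp⟩, ?_, ?_⟩
  · refine (ha.image Sum.inl_injective).mono ?_
    rintro _ ⟨v, ⟨hav, hvb : v ≠ b⟩, rfl⟩
    have hva : v ≠ a := hav.ne'
    simpa [hab.ne, hva, hvb] using hav
  · refine (hb.image Sum.inl_injective).mono ?_
    rintro _ ⟨v, ⟨hbv, hva : v ≠ a⟩, rfl⟩
    have hvb : v ≠ b := hbv.ne'
    simpa [hab.ne', hva, hvb] using hbv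

theorem IsCutComponent.preimage_inl {C : Set (V ⊕ Fin 2)}
    (hC : IsCutComponent (G.doubleSubdivision a b) (.inl x) (.inl y) C) (hab : G.Adj a b)
    (hne : (Sum.inl ⁻¹' C).Nonempty) : IsCutComponent G x y (Sum.inl ⁻¹' C) where
  connected := connected_induce_preimage_inl hab hC.connected hne
  left_notMem := hC.left_notMem
  right_notMem := hC.right_notMem
  mem_of_adj {u v} hu huv hvx hvy := by
    have hvx' := Sum.inl_injective.ne (β := V ⊕ Fin 2) hvx
    have hvy' := Sum.inl_injective.ne (β := V ⊕ Fin 2) hvy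
    by_cases hs : s(u, v) = s(a, b)
    · have hends : (u = a ∨ u = b) ∧ (v = a ∨ v = b) := by grind [Sym2.eq_iff]
      have hinr : Sum.inr 0 ∈ C := hC.mem_of_adj hu hends.1 Sum.inr_ne_inl Sum.inr_ne_inl
      exact hC.mem_of_adj hinr hends.2 hvx' hvy'
    · exact hC.mem_of_adj hu (doubleSubdivision_adj_inl_inl.2 ⟨huv, hs⟩) hvx' hvy'

theorem IsThickCut.left_ne_inl {E : Fin 2 → Set V} {y : V ⊕ Fin 2} {C : Set (V ⊕ Fin 2)}
    (hE : IsSplit G a b c E) (h : IsEdgeRobust G) (hcb : c ≠ b) (ha : G.neighborSet a = {b, c})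
    {x : V ⊕ Fin 2} (hC : IsThickCut (G.doubleSubdivision a b) x y C) : x ≠ .inl a := by
  rintro rfl
  have hab : G.Adj a b := ha.ge (by simp)
  have hac : G.Adj a c := ha.ge (by simp)
  have h' := h.doubleSubdivision hab
  have hF := hE.extendSet hab
  have hbc' := Sum.inl_injective.ne (β := V ⊕ Fin 2) hcb.symm
  have neighbor_eq : ∀ {d}, (G.doubleSubdivision a b).Adj (.inl a) d →
      d = .inl c ∨ ∃ i, d = .inr i := fun hd =>
    ((neighborSet_inl_left ha hcb).le hd).imp_right (by grind)
  obtain ⟨u, ⟨hau, huC⟩, v, ⟨hav, hvC⟩, huv⟩ := hC.left_nontrivial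
  obtain ⟨i, hi⟩ : ∃ i, Sum.inr i ∈ C := by
    obtain rfl | ⟨i, rfl⟩ := neighbor_eq hau
    · obtain rfl | ⟨i, rfl⟩ := neighbor_eq hav
      exacts [(huv rfl).elim, ⟨i, hvC⟩]
    · exact ⟨i, huC⟩
  by_cases hyb : y = .inl b
  · rw [eq_singleton_inr_of_notMem hC.connected hi hC.left_notMem (hyb ▸ hC.right_notMem)]
      at huC hvC
    exact huv (huC.trans hvC.symm)
  have hbC : .inl b ∈ C :=
    hC.mem_of_adj hi (by simp) (Sum.inl_injective.ne hab.ne') (Ne.symm hyb)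
  obtain ⟨w, hw⟩ := hC.exists_notMem
  obtain ⟨d, hdC, hdy, had⟩ := h'.exists_adj_left_notMem hC.toIsCutComponent hw hC.ne
  obtain ⟨k, hk⟩ := hF.exists_subset_of_mem h' hbc' hC.toIsCutComponent hF.notMem hbC
  refine hdC ?_
  obtain rfl | ⟨j, rfl⟩ := neighbor_eq had
  · obtain ⟨q, hcq, hq⟩ := h'.neighborSet_right_inter_nonempty hbc' (hF.isCutComponent k)
    exact hC.mem_of_adj (hk hq) hcq.symm (Sum.inl_injective.ne hac.ne') hdy
  · exact hC.mem_of_adj hbC (by simp) Sum.inr_ne_inl hdy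

theorem IsThickCut.nontrivial_neighborSet_inter_preimage_inl {E : Fin 2 → Set V}
    {C : Set (V ⊕ Fin 2)} (hE : IsSplit G a b c E) (h : IsEdgeRobust G) (hcb : c ≠ b)
    (ha : G.neighborSet a = {b, c}) (hx : x ≠ a) (hy : y ≠ a)
    (hC : IsThickCut (G.doubleSubdivision a b) (.inl x) (.inl y) C) :
    (G.neighborSet x ∩ Sum.inl ⁻¹' C).Nontrivial := by
  have hab : G.Adj a b := ha.ge (by simp)
  have hac : G.Adj a c := ha.ge (by simp)
  by_cases hinr : ∃ i, Sum.inr i ∈ C ∧ (G.doubleSubdivision a b).Adj (.inl x) (.inr i)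
  · obtain ⟨i, hi, hxi⟩ := hinr
    obtain rfl : x = b := (doubleSubdivision_adj_inl_inr.1 hxi).resolve_left hx
    have haC : .inl a ∈ C := hC.mem_of_adj hi (by simp) (Sum.inl_injective.ne hx.symm)
      (Sum.inl_injective.ne hy.symm)
    have hcy : c ≠ y := by
      rintro rfl
      have hsub : C ⊆ extendSet a x {a} := ((isCutComponent_singleton ha).extendSet
        hab).subset_of_connected hC.connected hC.left_notMem hC.right_notMem ⟨_, haC, rfl⟩
      refine hC.right_nontrivial.not_subset_singleton (x := .inl a) ?_
      rintro (v | j) ⟨hcv, hv⟩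
      · exact congrArg Sum.inl (hsub hv)
      · have hcj : c = a ∨ c = x := hcv
        exact (hcj.elim hac.ne' hcb).elim
    have hcC : .inl c ∈ C := hC.mem_of_adj haC
      (doubleSubdivision_adj_inl_inl.2 ⟨hac, by grind⟩) (Sum.inl_injective.ne hcb)
      (Sum.inl_injective.ne hcy)
    obtain ⟨k, hk⟩ := (hE.extendSet hab).symm.exists_subset_of_mem (h.doubleSubdivision hab)
      (Sum.inl_injective.ne hcb) hC.toIsCutComponent
      (fun k => (hE.isCutComponent k).left_notMem) hcC
    obtain ⟨d, hxd, hd⟩ := h.neighborSet_left_inter_nonempty hcb.symm (hE.isCutComponent k)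
    exact ⟨a, ⟨hab.symm, haC⟩, d, ⟨hxd, hk hd⟩, (ne_of_mem_of_not_mem hd (hE.notMem k)).symm⟩
  · push Not at hinr
    obtain ⟨u | i, ⟨hxu, hu⟩, v | j, ⟨hxv, hv⟩, huv⟩ := hC.left_nontrivial
    · exact ⟨u, ⟨(doubleSubdivision_adj_inl_inl.1 hxu).1, hu⟩, v,
        ⟨(doubleSubdivision_adj_inl_inl.1 hxv).1, hv⟩, ne_of_apply_ne _ huv⟩
    · exact (hinr j hv hxv).elim
    · exact (hinr i hu hxu).elim
    · exact (hinr i hu hxu).elim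

theorem IsSplit.hasThickCut_of_doubleSubdivision {E : Fin 2 → Set V} (hE : IsSplit G a b c E)
    (h : IsEdgeRobust G) (hcb : c ≠ b) (ha : G.neighborSet a = {b, c})
    (hC : HasThickCut (G.doubleSubdivision a b)) : HasThickCut G := by
  have hab : G.Adj a b := ha.ge (by simp)
  have h' := h.doubleSubdivision hab
  obtain ⟨x | i, y | j, C, hC⟩ := hC
  · have hx : x ≠ a := ne_of_apply_ne _ (hC.left_ne_inl hE h hcb ha)
    have hy : y ≠ a := ne_of_apply_ne _ (hC.symm.left_ne_inl hE h hcb ha)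
    have hleft := hC.nontrivial_neighborSet_inter_preimage_inl hE h hcb ha hx hy
    have hright := hC.symm.nontrivial_neighborSet_inter_preimage_inl hE h hcb ha hy hx
    refine ⟨x, y, Sum.inl ⁻¹' C, hC.toIsCutComponent.preimage_inl hab
      (hleft.nonempty.mono Set.inter_subset_right), ne_of_apply_ne _ hC.ne, ?_, hleft, hright⟩
    obtain ⟨v | i, hvx, hvy, hvC⟩ := hC.exists_notMem
    · exact ⟨v, ne_of_apply_ne _ hvx, ne_of_apply_ne _ hvy, hvC⟩
    · exact ⟨a, hx.symm, hy.symm, fun haC => hvC (hC.mem_of_adj haC (by simp) hvx hvy)⟩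
  · exact (hC.symm.neighborSet_left_ne_pair h' _ _ (neighborSet_inr j)).elim
  · exact (hC.neighborSet_left_ne_pair h' _ _ (neighborSet_inr i)).elim
  · exact (hC.neighborSet_left_ne_pair h' _ _ (neighborSet_inr i)).elim

end ThickCutDoubleSubdivision

section TripleDoubledTriangle

/-- The vertex type of `H0`. -/
abbrev H0Vertex : Type := ((Fin 3 ⊕ Fin 2) ⊕ Fin 2) ⊕ Fin 2

instance : DecidableRel H0.Adj := by unfold H0; infer_instance

instance (w h h' : H0Vertex) : Decidable (H0.neighborSet w ⊆ {h, h'}) :=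
  decidable_of_iff (∀ u, H0.Adj w u → u = h ∨ u = h') Iff.rfl

theorem exists_H0_adj_ne : ∀ w x, ∃ u ≠ x, H0.Adj w u := by decide

variable {w w' h h' : H0Vertex}

theorem not_H0_adj_of_neighborSet_subset_pair (hw : H0.neighborSet w ⊆ {h, h'}) :
    ¬ H0.Adj h h' := by
  decide +revert

set_option synthInstance.maxSize 1000 in
theorem exists_H0_adj_left_of_neighborSet_subset_pair (hw : H0.neighborSet w ⊆ {h, h'})
    (x : H0Vertex) : ∃ z ≠ x, H0.Adj h z ∧ z ≠ h' ∧ ¬ H0.neighborSet z ⊆ {h, h'} := by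
  decide +revert

set_option synthInstance.maxSize 1000 in
theorem exists_H0_adj_of_neighborSet_subset_pair (hne : w ≠ w')
    (hw : H0.neighborSet w ⊆ {h, h'}) (hw' : H0.neighborSet w' ⊆ {h, h'}) :
    ∃ g, g ≠ h ∧ g ≠ h' ∧
      ∀ u, u ≠ h → u ≠ h' → u ≠ w → u ≠ w' → u = g ∨ H0.Adj u g := by
  decide +revert

end TripleDoubledTriangle

theorem IsSplit.exists_forall_disjoint {G : SimpleGraph V} {s y z : V} {E : Fin 2 → Set V}
    {B : H0Vertex → Set V} (hE : IsSplit G s y z E)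
    (hB : IsModel H0 G B) {h h' w₀ w₁ : H0Vertex} (hy : y ∈ B h)
    (hz : z ∈ B h') (hw₀ : H0.neighborSet w₀ ⊆ {h, h'}) (hw₁ : H0.neighborSet w₁ ⊆ {h, h'})
    (hne : w₀ ≠ w₁) (hdisj : ∀ k, Disjoint (B w₀) (E k)) :
    ∃ k, ∀ w, w ≠ w₁ → w ≠ h → w ≠ h' → Disjoint (B w) (E k) := by
  obtain ⟨g, hgh, hgh', hg⟩ := exists_H0_adj_of_neighborSet_subset_pair hne hw₀ hw₁
  have hyB : ∀ {w}, w ≠ h → y ∉ B w := fun hw hyw => hw (hB.eq_of_mem hyw hy)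
  have hzB : ∀ {w}, w ≠ h' → z ∉ B w := fun hw hzw => hw (hB.eq_of_mem hzw hz)
  obtain ⟨k, hk⟩ := hE.exists_disjoint_of_connected (hB.connected g) (hyB hgh) (hzB hgh')
  refine ⟨k, fun w h₁ h₂ h₃ => ?_⟩
  obtain rfl | h₀ := eq_or_ne w w₀
  · exact hdisj k
  obtain rfl | hwg := hg w h₂ h₃ h₀ h₁
  · exact hk
  · exact hB.disjoint_of_adj (hE.isCutComponent k) (hyB h₂) (hzB h₃) (hyB hgh) (hzB hgh') hwg hk

section MinorOfDoubleSubdivision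

variable {G : SimpleGraph V} {H : SimpleGraph W} {a b c : V} {B : W → Set (V ⊕ Fin 2)}
  {w r s : W}

theorem exists_eq_singleton_inr {U : Set (V ⊕ Fin 2)}
    (hU : ((G.doubleSubdivision a b).induce U).Connected) (hinl : ¬ (Sum.inl ⁻¹' U).Nonempty) :
    ∃ i, U = {.inr i} := by
  obtain ⟨v | i, hi⟩ := nonempty_of_connected_induce hU
  · exact (hinl ⟨v, hi⟩).elim
  · exact ⟨i, eq_singleton_inr_of_notMem hU hi (fun ha => hinl ⟨a, ha⟩) fun hb => hinl ⟨b, hb⟩⟩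

theorem IsModel.mem_or_mem_of_adj_singleton_inr (hB : IsModel H (G.doubleSubdivision a b) B)
    {i : Fin 2} (hw : B w = {.inr i}) {u : W} (hwu : H.Adj w u) :
    .inl a ∈ B u ∨ .inl b ∈ B u := by
  obtain ⟨p, hp, q, hq, hpq⟩ := hB.exists_adj w u hwu
  obtain rfl : p = .inr i := hw.le hp
  obtain rfl | rfl : q = .inl a ∨ q = .inl b := (neighborSet_inr i).le hpq
  exacts [.inl hq, .inr hq]

theorem IsModel.neighborSet_subset_pair_of_singleton_inr
    (hB : IsModel H (G.doubleSubdivision a b) B) (ha : .inl a ∈ B r) (hb : .inl b ∈ B s)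
    {i : Fin 2} (hw : B w = {.inr i}) : H.neighborSet w ⊆ {r, s} := fun _ hwu =>
  (hB.mem_or_mem_of_adj_singleton_inr hw hwu).imp (hB.eq_of_mem · ha) (hB.eq_of_mem · hb)

theorem IsModel.inl_mem_of_forall_exists_adj (hB : IsModel H (G.doubleSubdivision a b) B)
    (ha : G.neighborSet a = {b, c}) (har : .inl a ∈ B r) (hbs : .inl b ∈ B s) (hrs : r ≠ s)
    (hadj : ∀ x, ∃ z ≠ x, H.Adj r z ∧ z ≠ s ∧ (Sum.inl ⁻¹' B z).Nonempty) : .inl c ∈ B r := by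
  by_contra hcr
  have hab : G.Adj a b := ha.ge (by simp)
  have hF := (isCutComponent_singleton ha).extendSet hab
  have hbr : .inl b ∉ B r := fun hbr => hrs (hB.eq_of_mem hbr hbs)
  have hrF : B r ⊆ extendSet a b {a} :=
    hF.subset_of_connected (hB.connected r) hbr hcr ⟨_, har, rfl⟩
  have inl_mem : ∀ {z}, H.Adj r z → z ≠ s → (Sum.inl ⁻¹' B z).Nonempty → .inl c ∈ B z := by
    intro z hrz hzs hz
    have haz : .inl a ∉ B z := fun haz => hrz.ne (hB.eq_of_mem har haz)
    have hbz : .inl b ∉ B z := fun hbz => hzs (hB.eq_of_mem hbz hbs)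
    by_contra hcz
    obtain ⟨p, hp, q, hq, hpq⟩ := hB.exists_adj r z hrz
    have hqF : q ∈ extendSet a b {a} := hF.mem_of_adj (hrF hp) hpq
      (ne_of_mem_of_not_mem hq hbz) (ne_of_mem_of_not_mem hq hcz)
    obtain q | i := q
    · obtain rfl : q = a := hqF
      exact haz hq
    · exact (mem_or_mem_of_connected_induce (hB.connected z) hz hq).elim haz hbz
  obtain ⟨x, -, hrx, hxs, hx⟩ := hadj r
  obtain ⟨y, hyx, hry, hys, hy⟩ := hadj x
  exact hyx (hB.eq_of_mem (inl_mem hry hys hy) (inl_mem hrx hxs hx))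

theorem IsModel.eq_or_eq_of_inr_mem (hB : IsModel H (G.doubleSubdivision a b) B) {w₀ w₁ : W}
    {i j : Fin 2} (hw : w₀ ≠ w₁) (hw₀ : B w₀ = {.inr i}) (hw₁ : B w₁ = {.inr j})
    {u : W} {l : Fin 2} (hl : .inr l ∈ B u) :
    u = w₀ ∨ u = w₁ := by
  have hij : i ≠ j := by
    rintro rfl
    exact hw (hB.eq_of_mem (hw₀.ge rfl) (hw₁.ge rfl))
  obtain rfl | rfl : l = i ∨ l = j := by lia
  exacts [.inl (hB.eq_of_mem hl (hw₀.ge rfl)), .inr (hB.eq_of_mem hl (hw₁.ge rfl))]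

-- The end `a` of degree two of the subdivided edge takes over the role of the new vertex.
theorem IsModel.isMinor_of_singleton_inr (hB : IsModel H (G.doubleSubdivision a b) B)
    (hcb : c ≠ b) (ha : G.neighborSet a = {b, c}) {i : Fin 2} (hw : B w = {.inr i})
    (har : .inl a ∈ B r) (hcr : .inl c ∈ B r) (hbs : .inl b ∈ B s) (hrs : r ≠ s)
    (hadj : ¬ H.Adj r s) (hinr : ∀ u j, B u = {.inr j} → u = w) : H.IsMinor G := by
  classical
  have hab : G.Adj a b := ha.ge (by simp)
  have hac : G.Adj a c := ha.ge (by simp)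
  have hF := ((isCutComponent_singleton ha).extendSet hab).symm
  have hinl : ∀ u, u ≠ w → (Sum.inl ⁻¹' B u).Nonempty := fun u huw => by_contra fun hu =>
    have ⟨j, hj⟩ := exists_eq_singleton_inr (hB.connected u) hu
    huw (hinr u j hj)
  have hdisj : ∀ u, u ≠ w → u ≠ r → u ≠ s → Disjoint (B u) (extendSet a b {a}) := by
    intro u huw hur hus
    have hau : .inl a ∉ B u := fun hau => hur (hB.eq_of_mem hau har)
    have hbu : .inl b ∉ B u := fun hbu => hus (hB.eq_of_mem hbu hbs)
    refine Set.disjoint_left.2 ?_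
    rintro (v | j) hv hvF
    · obtain rfl : v = a := hvF
      exact hau hv
    · exact (mem_or_mem_of_connected_induce (hB.connected u) (hinl u huw) hv).elim hau hbu
  have hB' := hB.reroute hF ⟨.inl a, by simp [hac.symm, hcb, hab.ne], rfl⟩ ⟨.inr 0, by simp⟩
    hcr hbs hrs hadj (hB.neighborSet_subset_pair_of_singleton_inr har hbs hw) hdisj
  refine isMinor_iff_exists_isModel.2 ⟨_, hB'.of_doubleSubdivision hab fun u => ?_⟩
  obtain rfl | huw := eq_or_ne u w
  · exact ⟨a, by simp⟩
  rw [Function.update_of_ne huw]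
  obtain ⟨v, hv⟩ := hinl u huw
  obtain rfl | hva := eq_or_ne v a
  · obtain rfl := hB.eq_of_mem har hv
    exact ⟨c, hcr, hac.ne'⟩
  · exact ⟨v, hv, hva⟩

theorem IsModel.exists_mem_of_singleton_inr
    {B : H0Vertex → Set (V ⊕ Fin 2)}
    (hB : IsModel H0 (G.doubleSubdivision a b) B) (ha : G.neighborSet a = {b, c})
    {w : H0Vertex} {i : Fin 2} (hw : B w = {.inr i}) :
    ∃ h h', h ≠ h' ∧ .inl a ∈ B h ∧ .inl c ∈ B h ∧ .inl b ∈ B h' := by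
  obtain ⟨h, h', hne, hah, hbh'⟩ : ∃ h h', h ≠ h' ∧ .inl a ∈ B h ∧ .inl b ∈ B h' := by
    obtain ⟨u, -, hu⟩ := exists_H0_adj_ne w w
    obtain ⟨v, hvu, hv⟩ := exists_H0_adj_ne w u
    have hu' := hB.mem_or_mem_of_adj_singleton_inr hw hu
    have hv' := hB.mem_or_mem_of_adj_singleton_inr hw hv
    grind [hB.eq_of_mem]
  have hpair : ∀ {z j}, B z = {.inr j} → H0.neighborSet z ⊆ {h, h'} :=
    hB.neighborSet_subset_pair_of_singleton_inr hah hbh'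
  refine ⟨h, h', hne, hah, hB.inl_mem_of_forall_exists_adj ha hah hbh' hne fun x => ?_, hbh'⟩
  obtain ⟨z, hzx, hhz, hzh', hz⟩ := exists_H0_adj_left_of_neighborSet_subset_pair (hpair hw) x
  refine ⟨z, hzx, hhz, hzh', by_contra fun hinl => ?_⟩
  obtain ⟨j, hj⟩ := exists_eq_singleton_inr (hB.connected z) hinl
  exact hz (hpair hj)

theorem IsSplit.isMinor_of_two_singleton_inr {E : Fin 2 → Set V}
    {B : H0Vertex → Set (V ⊕ Fin 2)} (hE : IsSplit G a b c E)
    (hG : IsEdgeRobust G) (hcb : c ≠ b) (ha : G.neighborSet a = {b, c})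
    (hB : IsModel H0 (G.doubleSubdivision a b) B)
    {h h' w₀ w₁ : H0Vertex} (hne : h ≠ h') (hah : .inl a ∈ B h)
    (hch : .inl c ∈ B h) (hbh' : .inl b ∈ B h') {i j : Fin 2} (hw : w₀ ≠ w₁)
    (hw₀ : B w₀ = {.inr i}) (hw₁ : B w₁ = {.inr j}) : H0.IsMinor G := by
  have hab : G.Adj a b := ha.ge (by simp)
  have hF := (hE.extendSet hab).symm
  have hpair : ∀ {z j}, B z = {.inr j} → H0.neighborSet z ⊆ {h, h'} :=
    hB.neighborSet_subset_pair_of_singleton_inr hah hbh'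
  have hadj := not_H0_adj_of_neighborSet_subset_pair (hpair hw₀)
  have hinr : ∀ k l, Sum.inr l ∉ GeneralisedTriangle.extendSet a b (E k) := fun k l => by
    simp [hE.notMem k, (hE.isCutComponent k).left_notMem]
  obtain ⟨k, hk⟩ := hF.exists_forall_disjoint hB hch hbh' (hpair hw₀) (hpair hw₁) hw
    fun k => by simpa only [hw₀, Set.disjoint_singleton_left] using hinr k i
  have hG' := hG.doubleSubdivision hab
  have hbc' := Sum.inl_injective.ne (β := V ⊕ Fin 2) hcb
  have hB' := hB.reroute (hF.isCutComponent k)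
    (hG'.neighborSet_left_inter_nonempty hbc' (hF.isCutComponent k))
    (hG'.neighborSet_right_inter_nonempty hbc' (hF.isCutComponent k)) hch hbh' hne hadj
    (hpair hw₁) hk
  have ne_w₁ : ∀ {u v}, Sum.inl v ∈ B u → u ≠ w₁ := by
    rintro u v hv rfl
    simp [hw₁] at hv
  refine hB'.isMinor_of_singleton_inr (w := w₀) (r := h) (s := h') (i := i) hcb ha ?_ ?_ ?_ ?_
    hne hadj fun u l hul => ?_
  · rw [Function.update_of_ne hw, hw₀]
    exact sdiff_eq_left.2 (by simpa only [Set.disjoint_singleton_left] using hinr k i)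
  · rw [Function.update_of_ne (ne_w₁ hah)]
    exact ⟨hah, hE.notMem k⟩
  · rw [Function.update_of_ne (ne_w₁ hch)]
    exact ⟨hch, (hE.isCutComponent k).right_notMem⟩
  · rw [Function.update_of_ne (ne_w₁ hbh')]
    exact ⟨hbh', (hE.isCutComponent k).left_notMem⟩
  · have hl := hul.ge rfl
    obtain rfl | huw₁ := eq_or_ne u w₁
    · rw [Function.update_self] at hl
      exact (hinr k l hl).elim
    rw [Function.update_of_ne huw₁] at hl
    exact (hB.eq_or_eq_of_inr_mem hw hw₀ hw₁ hl.1).resolve_right huw₁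

theorem IsSplit.isMinor_of_doubleSubdivision {E : Fin 2 → Set V} (hE : IsSplit G a b c E)
    (hG : IsEdgeRobust G) (hcb : c ≠ b) (ha : G.neighborSet a = {b, c})
    (hH : H0.IsMinor (G.doubleSubdivision a b)) : H0.IsMinor G := by
  obtain ⟨B, hB⟩ := isMinor_iff_exists_isModel.1 hH
  by_cases hinl : ∀ w, (Sum.inl ⁻¹' B w).Nonempty
  · exact isMinor_iff_exists_isModel.2 ⟨_, hB.of_doubleSubdivision (ha.ge (by simp)) hinl⟩
  push Not at hinl
  obtain ⟨w₀, hw₀⟩ := hinl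
  obtain ⟨i, hi⟩ := exists_eq_singleton_inr (hB.connected w₀) (by simp [hw₀])
  obtain ⟨h, h', hne, hah, hch, hbh'⟩ := hB.exists_mem_of_singleton_inr ha hi
  by_cases hinr : ∀ w j, B w = {.inr j} → w = w₀
  · have hadj := not_H0_adj_of_neighborSet_subset_pair
      (hB.neighborSet_subset_pair_of_singleton_inr hah hbh' hi)
    exact hB.isMinor_of_singleton_inr hcb ha hi hah hch hbh' hne hadj hinr
  push Not at hinr
  obtain ⟨w₁, j, hj, hw⟩ := hinr
  exact hE.isMinor_of_two_singleton_inr hG hcb ha hB hne hah hch hbh' hw.symm hi hj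

end MinorOfDoubleSubdivision

section Invariant

variable {G : SimpleGraph V} {a b c : V}

/-- The properties of the generalised triangles other than `K₃` that are established by induction
along double subdivisions. -/
structure TriangleInvariant (G : SimpleGraph V) : Prop where
  robust : IsEdgeRobust G
  splits : HasDegreeTwoSplits G
  rooted : ThickEdgesRooted G
  hasThickCut_iff : HasThickCut G ↔ H0.IsMinor G

theorem TriangleInvariant.hasThickCut_doubleSubdivision_iff (h : TriangleInvariant G)
    (hcb : c ≠ b) (ha : G.neighborSet a = {b, c}) :
    HasThickCut (G.doubleSubdivision a b) ↔ H0.IsMinor (G.doubleSubdivision a b) := by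
  obtain ⟨E, hE⟩ := h.splits a b c hcb.symm ha
  constructor
  · intro hC
    have hm := h.hasThickCut_iff.1 (hE.hasThickCut_of_doubleSubdivision h.robust hcb ha hC)
    obtain ⟨B, hB⟩ := isMinor_iff_exists_isModel.1 hm
    obtain ⟨B', hB', -⟩ := hB.exists_lift a b
    exact isMinor_iff_exists_isModel.2 ⟨B', hB'⟩
  · intro hm
    have hC := h.hasThickCut_iff.2 (hE.isMinor_of_doubleSubdivision h.robust hcb ha hm)
    exact hC.doubleSubdivision (ha.ge (by simp))

theorem TriangleInvariant.doubleSubdivision (h : TriangleInvariant G) (hab : G.Adj a b) :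
    TriangleInvariant (G.doubleSubdivision a b) where
  robust := h.robust.doubleSubdivision hab
  splits := h.splits.doubleSubdivision h.robust hab
  rooted := h.rooted.doubleSubdivision h.splits h.robust hab
  hasThickCut_iff := by
    obtain ha | ⟨c, hcb, ha⟩ := h.robust.nontrivial_or_neighborSet_eq_pair hab
    · obtain hb | ⟨c, hca, hb⟩ := h.robust.nontrivial_or_neighborSet_eq_pair hab.symm
      · exact iff_of_true (h.robust.hasThickCut_doubleSubdivision hab ha hb)
          (h.rooted a b hab ha hb).isMinor_doubleSubdivision
      · rw [doubleSubdivision_comm]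
        exact h.hasThickCut_doubleSubdivision_iff hca hb
    · exact h.hasThickCut_doubleSubdivision_iff hcb ha

end Invariant

section Triangle

variable {a b : Fin 3}

theorem isEdgeRobust_top_fin_three : IsEdgeRobust (⊤ : SimpleGraph (Fin 3)) := by
  have connected : ∀ S : Set (Fin 3), S.Nonempty → ((⊤ : SimpleGraph (Fin 3)).induce S).Connected :=
    fun S hS => by
      have := hS.coe_sort
      rw [induce_top]
      exact connected_top
  refine ⟨connected_top, fun v => connected _ ⟨v + 1, by simp⟩, fun {u v} _ => connected _ ?_⟩
  have hw : ∀ u v : Fin 3, ∃ w, ¬ (w = u ∨ w = v) := by decide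
  exact hw u v

theorem neighborSet_top_fin_three {s : Fin 3} (hab : a ≠ b) (hsa : s ≠ a) (hsb : s ≠ b) :
    (⊤ : SimpleGraph (Fin 3)).neighborSet s = {a, b} := by
  ext v
  simp only [mem_neighborSet, top_adj, Set.mem_insert_iff, Set.mem_singleton_iff]
  lia

theorem not_hasThickCut_top_fin_three : ¬ HasThickCut (⊤ : SimpleGraph (Fin 3)) := by
  rintro ⟨x, y, C, hC⟩
  have hx : ∀ x : Fin 3, x + 1 ≠ x + 2 ∧ x ≠ x + 1 ∧ x ≠ x + 2 := by decide
  exact hC.neighborSet_left_ne_pair isEdgeRobust_top_fin_three (x + 1) (x + 2)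
    (neighborSet_top_fin_three (hx x).1 (hx x).2.1 (hx x).2.2)

theorem not_H0_isMinor_of_card_lt [Fintype V] {G : SimpleGraph V} (h : Fintype.card V < 9) :
    ¬ H0.IsMinor G := by
  intro hm
  obtain ⟨B, hB⟩ := isMinor_iff_exists_isModel.1 hm
  have hcard := hB.card_le
  simp only [Fintype.card_sum, Fintype.card_fin] at hcard
  lia

theorem neighborSet_doubleSubdivision_top {s : Fin 3 ⊕ Fin 2} (hab : a ≠ b) (hsa : s ≠ .inl a)
    (hsb : s ≠ .inl b) :
    ((⊤ : SimpleGraph (Fin 3)).doubleSubdivision a b).neighborSet s = {.inl a, .inl b} := by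
  obtain s | i := s
  · have hsa' : s ≠ a := ne_of_apply_ne _ hsa
    have hsb' : s ≠ b := ne_of_apply_ne _ hsb
    rw [neighborSet_inl_of_ne hsa' hsb', neighborSet_top_fin_three hab hsa' hsb', Set.image_pair]
  · exact neighborSet_inr i

theorem thickEdgesRooted_doubleSubdivision_top (hab : a ≠ b) :
    ThickEdgesRooted ((⊤ : SimpleGraph (Fin 3)).doubleSubdivision a b) := by
  have eq_of_nontrivial : ∀ {u v},
      ((⊤ : SimpleGraph (Fin 3)).doubleSubdivision a b).Adj u v →
      (((⊤ : SimpleGraph (Fin 3)).doubleSubdivision a b).neighborSet u \ {v}).Nontrivial →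
      u = .inl a ∨ u = .inl b := by
    intro u v huv hu
    by_contra! hne
    rw [← mem_neighborSet, neighborSet_doubleSubdivision_top hab hne.1 hne.2] at huv
    rw [neighborSet_doubleSubdivision_top hab hne.1 hne.2] at hu
    obtain ⟨p, ⟨hp, hpv⟩, q, ⟨hq, hqv⟩, hpq⟩ := hu
    grind
  intro u v huv hu hv
  obtain rfl | rfl := eq_of_nontrivial huv hu <;>
    obtain rfl | rfl := eq_of_nontrivial huv.symm hv <;> simp at huv

theorem not_hasThickCut_doubleSubdivision_top (hab : a ≠ b) :
    ¬ HasThickCut ((⊤ : SimpleGraph (Fin 3)).doubleSubdivision a b) := by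
  rintro ⟨x, y, C, hC⟩
  have h := isEdgeRobust_top_fin_three.doubleSubdivision (a := a) (b := b) hab
  have hx : x = .inl a ∨ x = .inl b := by
    by_contra! hx
    exact hC.neighborSet_left_ne_pair h _ _ (neighborSet_doubleSubdivision_top hab hx.1 hx.2)
  have hy : y = .inl a ∨ y = .inl b := by
    by_contra! hy
    exact hC.symm.neighborSet_left_ne_pair h _ _ (neighborSet_doubleSubdivision_top hab hy.1 hy.2)
  obtain ⟨c, ⟨-, hc⟩, d, ⟨-, hd⟩, hcd⟩ := hC.left_nontrivial
  have hcx := ne_of_mem_of_not_mem hc hC.left_notMem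
  have hcy := ne_of_mem_of_not_mem hc hC.right_notMem
  have hN : ((⊤ : SimpleGraph (Fin 3)).doubleSubdivision a b).neighborSet c = {x, y} := by
    rw [neighborSet_doubleSubdivision_top hab] <;> grind [hC.ne]
  exact hcd ((isCutComponent_singleton hN).subset_of_connected hC.connected hC.left_notMem
    hC.right_notMem ⟨c, hc, rfl⟩ hd).symm

theorem triangleInvariant_doubleSubdivision_top (hab : a ≠ b) :
    TriangleInvariant ((⊤ : SimpleGraph (Fin 3)).doubleSubdivision a b) where
  robust := isEdgeRobust_top_fin_three.doubleSubdivision hab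
  splits := isEdgeRobust_top_fin_three.hasDegreeTwoSplits_doubleSubdivision hab
    fun s y z hsa hsb _ hs => .inl <| by
      rw [neighborSet_top_fin_three hab hsa hsb, Set.pair_eq_pair_iff] at hs
      rw [Sym2.eq_iff]
      tauto
  rooted := thickEdgesRooted_doubleSubdivision_top hab
  hasThickCut_iff := iff_of_false (not_hasThickCut_doubleSubdivision_top hab)
    (not_H0_isMinor_of_card_lt (by simp))

end Triangle

theorem exists_iso_of_isGeneralisedTriangle {G : SimpleGraph V} (h : G.IsGeneralisedTriangle) :
    Nonempty (G ≃g (⊤ : SimpleGraph (Fin 3))) ∨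
      ∃ (V' : Type) (G' : SimpleGraph V'), TriangleInvariant G' ∧ Nonempty (G ≃g G') := by
  induction h with
  | triangle e => exact .inl ⟨e⟩
  | doubleSubdivision _ hab e ih =>
    right
    obtain ⟨⟨f⟩⟩ | ⟨V', G', hG', ⟨f⟩⟩ := ih
    · exact ⟨_, _, triangleInvariant_doubleSubdivision_top (f.map_adj_iff.2 hab),
        ⟨e.trans (doubleSubdivisionCongr f _ _)⟩⟩
    · exact ⟨_, _, hG'.doubleSubdivision (f.map_adj_iff.2 hab),
        ⟨e.trans (doubleSubdivisionCongr f _ _)⟩⟩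

theorem hasThickCut_congr {G : SimpleGraph V} {G' : SimpleGraph V'} (e : G ≃g G') :
    HasThickCut G ↔ HasThickCut G' :=
  ⟨fun ⟨_, _, _, hC⟩ => ⟨_, _, _, hC.map_iso e⟩,
    fun ⟨_, _, _, hC⟩ => ⟨_, _, _, hC.map_iso e.symm⟩⟩

theorem isEdgeRobust_of_isGeneralisedTriangle {G : SimpleGraph V}
    (h : G.IsGeneralisedTriangle) : IsEdgeRobust G := by
  obtain ⟨⟨e⟩⟩ | ⟨V', G', hG', ⟨e⟩⟩ := exists_iso_of_isGeneralisedTriangle h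
  exacts [isEdgeRobust_top_fin_three.map_iso e.symm, hG'.robust.map_iso e.symm]

theorem hasThickCut_iff_of_isGeneralisedTriangle {G : SimpleGraph V}
    (h : G.IsGeneralisedTriangle) : HasThickCut G ↔ H0.IsMinor G := by
  obtain ⟨⟨e⟩⟩ | ⟨V', G', hG', ⟨e⟩⟩ := exists_iso_of_isGeneralisedTriangle h <;>
    rw [hasThickCut_congr e, isMinor_congr e]
  · exact iff_of_false not_hasThickCut_top_fin_three (not_H0_isMinor_of_card_lt (by simp))
  · exact hG'.hasThickCut_iff

section PropertyP1

variable {G : SimpleGraph V} {x y : V}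

theorem neighborSet_twoCutBridge_left (hxy : ¬ G.Adj x y)
    (K : (G.induce ({x, y} : Set V)ᶜ).ConnectedComponent) :
    (G.twoCutBridge x y K).neighborSet x = G.neighborSet x ∩ Subtype.val '' K.supp := by
  ext v
  have hxv : G.Adj x v → v ≠ x ∧ v ≠ y := fun hxv => ⟨hxv.ne', fun hvy => hxy (hvy ▸ hxv)⟩
  simp only [twoCutBridge, Subgraph.mem_neighborSet, Subgraph.induce_adj, Subgraph.top_adj,
    Set.mem_union, Set.mem_insert_iff, Set.mem_singleton_iff, Set.mem_inter_iff, mem_neighborSet]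
  tauto

theorem neighborSet_twoCutBridge_right (hxy : ¬ G.Adj x y)
    (K : (G.induce ({x, y} : Set V)ᶜ).ConnectedComponent) :
    (G.twoCutBridge x y K).neighborSet y = G.neighborSet y ∩ Subtype.val '' K.supp := by
  ext v
  have hyv : G.Adj y v → v ≠ x ∧ v ≠ y := fun hyv => ⟨fun hvx => hxy (hvx ▸ hyv.symm), hyv.ne'⟩
  simp only [twoCutBridge, Subgraph.mem_neighborSet, Subgraph.induce_adj, Subgraph.top_adj,
    Set.mem_union, Set.mem_insert_iff, Set.mem_singleton_iff, Set.mem_inter_iff, mem_neighborSet]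
  tauto

theorem propertyP1_iff_forall_isCutComponent (hxy : ¬ G.Adj x y) :
    G.PropertyP1 x y ↔ ∀ C, IsCutComponent G x y C →
      (G.neighborSet x ∩ C).ncard = 1 ∨ (G.neighborSet y ∩ C).ncard = 1 := by
  simp only [PropertyP1, neighborSet_twoCutBridge_left hxy, neighborSet_twoCutBridge_right hxy]
  refine ⟨fun hP C hC => ?_, fun hP K => hP _ (isCutComponent_image_supp K)⟩
  obtain ⟨K, rfl⟩ := hC.exists_image_supp_eq
  exact hP K

theorem ncard_ne_one_iff_nontrivial {S : Set V} (hS : S.Nonempty) :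
    S.ncard ≠ 1 ↔ S.Nontrivial := by
  rw [← Set.not_subsingleton_iff, ne_eq, Set.ncard_eq_one,
    Set.exists_eq_singleton_iff_nonempty_subsingleton, and_iff_right hS]

theorem isTwoCut_iff_not_preconnected [Finite V] (hG : G.Connected) :
    G.IsTwoCut x y ↔ x ≠ y ∧ ¬ (G.induce {x, y}ᶜ).Preconnected := by
  have hcard : Nat.card G.ConnectedComponent = 1 := by
    have := hG.nonempty
    have := hG.preconnected.subsingleton_connectedComponent
    exact Nat.card_unique
  rw [IsTwoCut, IsCutSet, hcard, Finite.one_lt_card_iff_nontrivial,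
    ← not_subsingleton_iff_nontrivial]
  exact and_congr_right fun _ => not_congr
    ⟨fun _ u v => ConnectedComponent.exact (Subsingleton.elim _ _),
      Preconnected.subsingleton_connectedComponent⟩

theorem IsEdgeRobust.propertyP1_iff_forall_not_isThickCut [Finite V] (h : IsEdgeRobust G)
    (hcut : G.IsTwoCut x y) : G.PropertyP1 x y ↔ ∀ C, ¬ IsThickCut G x y C := by
  obtain ⟨hne, hxy⟩ := (isTwoCut_iff_not_preconnected h.connected).1 hcut
  rw [propertyP1_iff_forall_isCutComponent fun hadj =>
    hxy (h.connected_compl_pair hadj).preconnected]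
  refine forall_congr' fun C => ⟨fun hP hC => ?_, fun hC hcomp => ?_⟩
  · obtain hx | hy := hP hC.toIsCutComponent
    · exact (ncard_ne_one_iff_nontrivial hC.left_nontrivial.nonempty).2 hC.left_nontrivial hx
    · exact (ncard_ne_one_iff_nontrivial hC.right_nontrivial.nonempty).2 hC.right_nontrivial hy
  · by_contra! hncard
    refine hC ⟨hcomp, hne, ?_,
      (ncard_ne_one_iff_nontrivial (h.neighborSet_left_inter_nonempty hne hcomp)).1 hncard.1,
      (ncard_ne_one_iff_nontrivial (h.neighborSet_right_inter_nonempty hne hcomp)).1 hncard.2⟩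
    by_contra! hall
    have hC_eq : C = {x, y}ᶜ := by
      ext v
      have := hall v
      have := hcomp.left_notMem
      have := hcomp.right_notMem
      grind
    exact hxy (hC_eq ▸ hcomp.connected).preconnected

theorem IsThickCut.isTwoCut [Finite V] {C : Set V} (hC : IsThickCut G x y C) (hG : G.Connected) :
    G.IsTwoCut x y := by
  refine (isTwoCut_iff_not_preconnected hG).2 ⟨hC.ne, fun hxy => ?_⟩
  obtain ⟨v, hvx, hvy, hvC⟩ := hC.exists_notMem
  have hv : v ∈ ({x, y} : Set V)ᶜ := by simp [hvx, hvy]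
  have hconn : (G.induce ({x, y} : Set V)ᶜ).Connected :=
    { preconnected := hxy, nonempty := ⟨⟨v, hv⟩⟩ }
  obtain ⟨u, -, huC⟩ := hC.left_nontrivial.nonempty
  have hu : u ∈ ({x, y} : Set V)ᶜ := by
    simp [ne_of_mem_of_not_mem huC hC.left_notMem, ne_of_mem_of_not_mem huC hC.right_notMem]
  exact hvC (hC.subset_of_connected hconn (by simp) (by simp) ⟨u, hu, huC⟩ hv)

theorem IsEdgeRobust.forall_propertyP1_iff [Finite V] (h : IsEdgeRobust G) :
    (∀ x y, G.IsTwoCut x y → G.PropertyP1 x y) ↔ ¬ HasThickCut G := by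
  constructor
  · rintro hP ⟨x, y, C, hC⟩
    have hcut := hC.isTwoCut h.connected
    exact (h.propertyP1_iff_forall_not_isThickCut hcut).1 (hP x y hcut) C hC
  · exact fun hG x y hcut =>
      (h.propertyP1_iff_forall_not_isThickCut hcut).2 fun C hC => hG ⟨x, y, C, hC⟩

end PropertyP1

end GeneralisedTriangle

theorem lemma16 {V : Type*} [Finite V] (G : SimpleGraph V) (hG : G.IsGeneralisedTriangle) :
    G.MemK1 ↔ ¬ SimpleGraph.H0.IsMinor G := by
  rw [← GeneralisedTriangle.hasThickCut_iff_of_isGeneralisedTriangle hG, SimpleGraph.MemK1,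
    (GeneralisedTriangle.isEdgeRobust_of_isGeneralisedTriangle hG).forall_propertyP1_iff,
    and_iff_right hG]
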